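/- Let $m\ge 2$ and $n\ge 1$ be integers and $R=\mathbb C[x_0,\dots,x_n]$. Let $G=G(m,m,n+1)\subset \mathrm{GL}_{n+1}(\mathbb C)$ be the monomial group, consisting of all products of a diagonal matrix $\mathrm{diag}(a_0,\dots,a_n)$ with $a_i^m=1$ for all $i$ and $a_0\cdots a_n=1$ and a permutation matrix. Let $\mathcal A=\mathcal A(G)$ be its reflection arrangement, i.e. the set of the hyperplanes of $\mathbb C^{n+1}$ fixed pointwise by the pseudoreflections in $G$ (elements of finite order whose fixed space is a hyperplane). Let $F_{\mathcal A}=\prod_{H\in\mathcal A}\ell_H$ be a product of linear forms defining the hyperplanes, and let $$J(\mathcal A)=\sqrt{\left(\partial F_{\mathcal A}/\partial x_0,\dots,\partial F_{\mathcal A}/\partial x_n\right)}$$ be the ideal of the reduced singular locus of $\mathcal A$. For a matrix $N$ over $R$ let $I_n(N)$ be the ideal generated by its $n\times n$ minors. Let $M$ be the $(n+1)\times n$ matrix whose row with index $i$, $0\le i\le n$, is $$\Bigl(\prod_{k\ne i}x_k,\; x_i^{m-1},\; x_i^{2m-1},\;\dots,\; x_i^{(n-1)m-1}\Bigr).$$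 Then $$J(\mathcal A)=I_n(M)=\Bigl(x_s\prod_{\substack{0\le i<j\le n\\ i,j\ne s}}(x_i^m-x_j^m)\;\Bigm|\;0\le s\le n\Bigr).$$ Moreover, $f_0=x_0\cdots x_n$ and $f_d=\sum_{i=0}^n x_i^{md}$, $1\le d\le n$, form a system of basic invariants of $G$ (they are homogeneous, algebraically independent over $\mathbb C$, and generate the invariant ring $R^G$ as a $\mathbb C$-algebra), and $$J(\mathcal A)=I_n\bigl(\mathrm{Jac}(f_0,\dots,f_{n-1})\bigr),\qquad \mathrm{Jac}(f_0,\dots,f_{n-1})=\Bigl[\frac{\partial f_j}{\partial x_i}\Bigr]_{0\le i\le n,\;0\le j\le n-1}.$$ -/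

import Mathlib

open MvPolynomial

namespace ReflArr

noncomputable section

/-- The monomial group `G(m,m,N)` as a group of `N × N` complex matrices: the products of a
diagonal matrix, whose entries `a i` are `m`-th roots of unity with product `1`, and the matrix of
a permutation `σ` of the coordinates. -/
def monomialGroup (m N : ℕ) : Subgroup (GL (Fin N) ℂ) where
  carrier := {g | ∃ (a : Fin N → ℂ) (σ : Equiv.Perm (Fin N)),
    (∀ i, a i ^ m = 1) ∧ ∏ i, a i = 1 ∧
      ∀ i j, (g : Matrix (Fin N) (Fin N) ℂ) i j = if σ i = j then a i else 0}
  one_mem' := ⟨fun _ => 1, 1, by simp, by simp,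
    fun i j => by rw [Units.val_one, Matrix.one_apply]; rfl⟩
  mul_mem' := by
    rintro g h ⟨a, σ, ha, ha', hg⟩ ⟨b, τ, hb, hb', hh⟩
    refine ⟨fun i => a i * b (σ i), τ * σ, fun i => by rw [mul_pow, ha, hb, one_mul], ?_, ?_⟩
    · rw [Finset.prod_mul_distrib, ha', one_mul, Equiv.prod_comp σ b, hb']
    · intro i j
      rw [Units.val_mul, Matrix.mul_apply, Finset.sum_eq_single (σ i)]
      · rw [hg, hh, if_pos rfl, Equiv.Perm.mul_apply, mul_ite, mul_zero]
      · intro k _ hk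
        rw [hg, if_neg (Ne.symm hk), zero_mul]
      · simp
  inv_mem' := by
    rintro g ⟨a, σ, ha, ha', hg⟩
    have h0 : ∀ i, a i ≠ 0 := fun i h => by
      have : ∏ i, a i = 0 := Finset.prod_eq_zero (Finset.mem_univ i) h
      rw [ha'] at this
      exact one_ne_zero this
    refine ⟨fun i => (a (σ.symm i))⁻¹, σ⁻¹, fun i => by rw [inv_pow, ha, inv_one], ?_, ?_⟩
    · rw [Finset.prod_inv_distrib, Equiv.prod_comp σ.symm a, ha', inv_one]
    · have key : (Matrix.of fun i j => if σ⁻¹ i = j then (a (σ.symm i))⁻¹ else 0) *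
          (g : Matrix (Fin N) (Fin N) ℂ) = 1 := by
        ext i j
        rw [Matrix.mul_apply, Finset.sum_eq_single (σ⁻¹ i)]
        · rw [hg, Matrix.one_apply, Matrix.of_apply, if_pos rfl, show σ (σ⁻¹ i) = i from σ.apply_symm_apply i, mul_ite,
            mul_zero]
          exact if_congr Iff.rfl (inv_mul_cancel₀ (h0 _)) rfl
        · intro k _ hk
          rw [Matrix.of_apply, if_neg (Ne.symm hk), zero_mul]
        · simp
      intro i j
      rw [Matrix.coe_units_inv, Matrix.inv_eq_left_inv key]
      rfl

/-- The subspace of vectors fixed by `g`. -/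
def fixedSpace {N : ℕ} (g : GL (Fin N) ℂ) : Submodule ℂ (Fin N → ℂ) :=
  LinearMap.eqLocus (Matrix.toLin' (g : Matrix (Fin N) (Fin N) ℂ)) LinearMap.id

/-- A pseudoreflection: an element of finite order whose fixed space is a hyperplane
(in particular it is not the identity). -/
def IsPseudoreflection {N : ℕ} (g : GL (Fin N) ℂ) : Prop :=
  IsOfFinOrder g ∧ Module.finrank ℂ (fixedSpace g) + 1 = N

/-- The reflection arrangement of `G`: the set of the hyperplanes fixed pointwise by
the pseudoreflections in `G`. -/
def reflectionArrangement {N : ℕ} (G : Subgroup (GL (Fin N) ℂ)) :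
    Set (Submodule ℂ (Fin N → ℂ)) :=
  {H | ∃ g ∈ G, IsPseudoreflection g ∧ H = fixedSpace g}

/-- The linear form with coefficient vector `c`. -/
def linearForm {N : ℕ} (c : Fin N → ℂ) : MvPolynomial (Fin N) ℂ :=
  ∑ i, C (c i) * X i

/-- `F` is a defining polynomial of the finite hyperplane arrangement `A`: the product over the
hyperplanes `H` of `A` of one linear form with kernel `H`. Such an `F` is unique up to a nonzero
scalar factor. -/
def IsDefiningPolynomial {N : ℕ} (A : Set (Submodule ℂ (Fin N → ℂ)))
    (F : MvPolynomial (Fin N) ℂ) : Prop :=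
  ∃ (hA : A.Finite) (c : Submodule ℂ (Fin N → ℂ) → Fin N → ℂ),
    (∀ H ∈ A, ∀ v : Fin N → ℂ, v ∈ H ↔ c H ⬝ᵥ v = 0) ∧
      F = ∏ H ∈ hA.toFinset, linearForm (c H)

/-- The jacobian ideal of an arrangement, generated by the partial derivatives of its defining
polynomial. (Defining polynomials differ by nonzero scalars only, so all of them give the same
ideal and no choice of one is needed.) -/
def jacobianIdeal {N : ℕ} (A : Set (Submodule ℂ (Fin N → ℂ))) :
    Ideal (MvPolynomial (Fin N) ℂ) :=
  Ideal.span {P | ∃ F i, IsDefiningPolynomial A F ∧ P = pderiv i F}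

/-- The ideal of the reduced singular locus of an arrangement: the radical of the jacobian
ideal. -/
def singularLocusIdeal {N : ℕ} (A : Set (Submodule ℂ (Fin N → ℂ))) :
    Ideal (MvPolynomial (Fin N) ℂ) :=
  (jacobianIdeal A).radical

/-- The ideal generated by the `k × k` minors of a matrix. -/
def minorsIdeal {R : Type*} [CommRing R] {p q : ℕ} (k : ℕ) (M : Matrix (Fin p) (Fin q) R) :
    Ideal R :=
  Ideal.span {d | ∃ (r : Fin k ↪o Fin p) (c : Fin k ↪o Fin q), d = (M.submatrix r c).det}

/-- The jacobian matrix of a list of polynomials; the partial derivatives of the `j`-th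
polynomial form the `j`-th column. -/
def jacobianMatrix {N q : ℕ} (f : Fin q → MvPolynomial (Fin N) ℂ) :
    Matrix (Fin N) (Fin q) (MvPolynomial (Fin N) ℂ) :=
  Matrix.of fun i j => pderiv i (f j)

/-- The linear substitution `F(x) ↦ F(g x)`. -/
def substitution {N : ℕ} (g : GL (Fin N) ℂ) :
    MvPolynomial (Fin N) ℂ →ₐ[ℂ] MvPolynomial (Fin N) ℂ :=
  aeval fun i => linearForm ((g : Matrix (Fin N) (Fin N) ℂ) i)

/-- The ring of invariants of `G`. -/
def invariantRing {N : ℕ} (G : Subgroup (GL (Fin N) ℂ)) :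
    Subalgebra ℂ (MvPolynomial (Fin N) ℂ) :=
  ⨅ g ∈ G, AlgHom.equalizer (substitution g) (AlgHom.id ℂ _)

/-- A system of basic invariants of `G`: homogeneous, algebraically independent polynomials which
generate the ring of invariants. -/
def IsBasicInvariants {N : ℕ} (G : Subgroup (GL (Fin N) ℂ))
    (f : Fin N → MvPolynomial (Fin N) ℂ) : Prop :=
  (∀ j, ∃ d : ℕ, (f j).IsHomogeneous d) ∧ AlgebraicIndependent ℂ f ∧
    Algebra.adjoin ℂ (Set.range f) = invariantRing G

/-- The polynomials `f₀ = x₀ ⋯ xₙ` and `f_d = ∑ᵢ xᵢ ^ (m d)` for `1 ≤ d ≤ n`. -/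
def monomialInvariants (m n : ℕ) (d : Fin (n + 1)) : MvPolynomial (Fin (n + 1)) ℂ :=
  if (d : ℕ) = 0 then ∏ i, X i else ∑ i, X i ^ (m * (d : ℕ))

/-- The `(n + 1) × n` matrix whose row `i` is
`(∏_{k ≠ i} x_k, xᵢ ^ (m - 1), xᵢ ^ (2 m - 1), …, xᵢ ^ ((n - 1) m - 1))`. -/
def monomialMatrix (m n : ℕ) :
    Matrix (Fin (n + 1)) (Fin n) (MvPolynomial (Fin (n + 1)) ℂ) :=
  Matrix.of fun i j =>
    if (j : ℕ) = 0 then ∏ k ∈ Finset.univ.erase i, X k else X i ^ ((j : ℕ) * m - 1)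

/-- The polynomial `x_s ∏ (xᵢ ^ m - xⱼ ^ m)`, with the product over all pairs `i < j` of indices
different from `s`. -/
def monomialGenerator (m n : ℕ) (s : Fin (n + 1)) : MvPolynomial (Fin (n + 1)) ℂ :=
  X s * ∏ p : Fin (n + 1) × Fin (n + 1) with p.1 < p.2 ∧ p.1 ≠ s ∧ p.2 ≠ s,
    (X p.1 ^ m - X p.2 ^ m)

end

end ReflArr

/-!
Write `g_s = x_s ∏ (x_i ^ m - x_j ^ m)`, the product over the pairs avoiding `s`, and let `I` be the
ideal generated by the `g_s`. All four ideals of the statement are equal to `I`.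

*Minors.* Multiplying row `i` of a maximal minor of the monomial matrix by `x_i` gives a Vandermonde
determinant in the `x_i ^ m` whose first column carries the extra factor `x_0 ⋯ x_n`; cancelling the
row factors leaves `± g_s` (`associated_det_monomialMatrix`). The jacobian matrix arises from the
monomial matrix by multiplying its columns with nonzero constants.

*Singular locus.* The mirrors of `G(m, m, n + 1)` are the hyperplanes `x_i = ζ x_j` with `ζ ^ m = 1`
(`mem_reflectionArrangement`), so the defining polynomial is, up to a constant,
`Δ = ∏_{i<j} (x_i ^ m - x_j ^ m)`. Splitting off the factors of `Δ` that involve `x_i` shows that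
`g_i` divides `∂Δ/∂x_i`. Conversely Euler's identity and the product rule show that every `g_s`
vanishes at the common zeros of the partial derivatives, and the Nullstellensatz puts the `g_s` into
the radical of the jacobian ideal. It remains to see that `I` is radical
(`radical_span_monomialGenerator`).

*Why `I` is radical.* Both `I` and its radical are stable under the torus of `m`-th roots of unity,
so they decompose into components `x ^ e h(x ^ m)` with `0 ≤ e_i < m`. For such a component in the
radical, `h` vanishes on the linear flats `y_i = y_j = y_l`, on `y_i = y_j, y_l = y_r`, and on
`y_i = y_j = 0` whenever `e_i = e_j = 0`. Such an `h` is a combination of the products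
`∏ (y_i - y_j)` over the pairs avoiding `s`, times `y_s` if `e_s = 0` (`mem_span_flatGenerator`).
This is Lagrange interpolation along a variable `y_c`: on the hyperplane `y_c = y_j` the polynomial
`h` is divisible by the restriction of the `j`-th generator, while the other generators with index
different from `c` vanish there. After subtracting multiples of the generators, `h` is a multiple of
`∏_{j ≠ c} (y_c - y_j)`, and the cofactor vanishes on all flats that do not involve `c`, so that
induction on the number of indices applies. For the divisibility by `y_j` it matters that `c` is
chosen with `e_c = 0` as long as some index has this property.

*Invariants.* Invariance under the diagonal matrices leaves only components with constant `e`, that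
is `(x_0 ⋯ x_n) ^ a h(x ^ m)`, and invariance under permutations makes `h` symmetric. Newton's
identities express the elementary symmetric polynomials of the `x_i ^ m` by the power sums of lower
degree and `(x_0 ⋯ x_n) ^ m`. Since every `x_i` is integral over the algebra generated by the
`n + 1` invariants, a count of transcendence degrees gives their algebraic independence.
-/

namespace ReflArr

/-! ### Products of differences -/

section

variable {R : Type*} [CommRing R] {σ : Type*} [LinearOrder σ]

/-- The product of the differences `y i - y j` over all pairs `i < j` in `T`. -/
def pairProd (y : σ → R) (T : Finset σ) : R :=
  ∏ i ∈ T, ∏ j ∈ T, if i < j then y i - y j else 1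

theorem pairProd_insert (y : σ → R) {T : Finset σ} {c : σ} (hc : c ∉ T) :
    Associated (pairProd y (insert c T)) ((∏ j ∈ T, (y c - y j)) * pairProd y T) := by
  have h : pairProd y (insert c T) =
      (∏ j ∈ T, ((if c < j then y c - y j else 1) * (if j < c then y j - y c else 1))) *
        pairProd y T := by
    simp only [pairProd, Finset.prod_insert hc, if_neg (lt_irrefl c), one_mul,
      Finset.prod_mul_distrib, mul_assoc]
  rw [h]
  refine Associated.mul_right (Associated.prod T _ _ fun j hj => ?_) _
  rcases lt_trichotomy c j with h | h | h
  · simp [h, h.not_gt]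
  · exact absurd (h ▸ hj) hc
  · rw [if_neg h.not_gt, if_pos h, one_mul, ← neg_sub]
    exact (Associated.refl _).neg_left

theorem pairProd_erase (y : σ → R) {T : Finset σ} {c : σ} (hc : c ∈ T) :
    Associated (pairProd y T) ((∏ j ∈ T.erase c, (y c - y j)) * pairProd y (T.erase c)) := by
  simpa only [Finset.insert_erase hc] using pairProd_insert y (Finset.notMem_erase c T)

theorem map_pairProd {A : Type*} [CommRing A] (φ : R →+* A) (y : σ → R) (T : Finset σ) :
    φ (pairProd y T) = pairProd (fun i => φ (y i)) T := by
  simp only [pairProd, map_prod, apply_ite φ, map_sub, map_one]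

theorem pairProd_congr {y z : σ → R} {T : Finset σ} (h : ∀ i ∈ T, y i = z i) :
    pairProd y T = pairProd z T :=
  Finset.prod_congr rfl fun i hi => Finset.prod_congr rfl fun j hj => by rw [h i hi, h j hj]

theorem pairProd_eq_zero {y : σ → R} {T : Finset σ} {i j : σ} (hi : i ∈ T) (hj : j ∈ T)
    (hij : i ≠ j) (h : y i = y j) : pairProd y T = 0 := by
  wlog hlt : i < j generalizing i j
  · exact this hj hi hij.symm h.symm (lt_of_le_of_ne (not_lt.mp hlt) hij.symm)
  · refine Finset.prod_eq_zero hi (Finset.prod_eq_zero hj ?_)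
    rw [if_pos hlt, h, sub_self]

end

/-! ### Divisibility by differences of variables -/

section

variable {k : Type*} [Field k] {σ : Type*}

theorem X_sub_X_ne_zero {a b : σ} (hab : a ≠ b) : (X a - X b : MvPolynomial σ k) ≠ 0 :=
  sub_ne_zero.mpr fun h => hab (X_injective h)

variable [DecidableEq σ]

/-- The substitution `x_a ↦ b`, i.e. the restriction to the graph `x_a = b` when `b` does not
involve `x_a`. -/
noncomputable def replace (a : σ) (b : MvPolynomial σ k) :
    MvPolynomial σ k →ₐ[k] MvPolynomial σ k :=
  aeval (Function.update X a b)

@[simp] theorem replace_X_self (a : σ) (b : MvPolynomial σ k) : replace a b (X a) = b := by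
  simp [replace]

theorem replace_X_of_ne {a i : σ} (h : i ≠ a) (b : MvPolynomial σ k) :
    replace a b (X i) = X i := by
  simp [replace, h]

theorem X_sub_dvd_sub_replace (a : σ) (b p : MvPolynomial σ k) : X a - b ∣ p - replace a b p := by
  induction p using MvPolynomial.induction_on with
  | C r => simp [replace]
  | add p q hp hq =>
    rw [map_add, add_sub_add_comm]
    exact dvd_add hp hq
  | mul_X p i hp =>
    have h : p * X i - replace a b (p * X i) =
        (p - replace a b p) * X i + replace a b p * (X i - replace a b (X i)) := by
      rw [map_mul]; ring
    rw [h]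
    refine dvd_add (hp.mul_right _) (Dvd.dvd.mul_left ?_ _)
    by_cases hi : i = a
    · subst hi; simp
    · simp [replace_X_of_ne hi]

theorem X_sub_dvd_of_replace_eq_zero {a : σ} {b p : MvPolynomial σ k}
    (h : replace a b p = 0) : X a - b ∣ p := by
  simpa [h] using X_sub_dvd_sub_replace a b p

theorem X_sub_X_dvd_iff {a b : σ} (hab : a ≠ b) {p : MvPolynomial σ k} :
    X a - X b ∣ p ↔ replace a (X b) p = 0 := by
  refine ⟨?_, X_sub_dvd_of_replace_eq_zero⟩
  rintro ⟨q, rfl⟩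
  rw [map_mul, map_sub, replace_X_self, replace_X_of_ne hab.symm, sub_self, zero_mul]

theorem prime_X_sub_X {a b : σ} (hab : a ≠ b) : Prime (X a - X b : MvPolynomial σ k) := by
  refine ⟨X_sub_X_ne_zero hab, fun h => ?_, fun p q h => ?_⟩
  · have := (X_sub_X_dvd_iff hab).mp (h.dvd (a := 1))
    simp at this
  · simp only [X_sub_X_dvd_iff hab, map_mul] at h ⊢
    exact mul_eq_zero.mp h

theorem prod_X_sub_X_dvd {c : σ} {T : Finset σ} (hc : c ∉ T) {p : MvPolynomial σ k}
    (h : ∀ j ∈ T, replace c (X j) p = 0) : ∏ j ∈ T, (X c - X j) ∣ p := by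
  refine Finset.prod_dvd_of_isRelPrime ?_ fun j hj => X_sub_dvd_of_replace_eq_zero (h j hj)
  intro i hi j hj hij
  have hci : c ≠ i := fun e => hc (e ▸ hi)
  have hcj : c ≠ j := fun e => hc (e ▸ hj)
  refine ((prime_X_sub_X hci).irreducible.isRelPrime_iff_not_dvd).mpr ?_
  rw [X_sub_X_dvd_iff hci, map_sub, replace_X_self, replace_X_of_ne hcj.symm]
  exact X_sub_X_ne_zero hij

end

/-! ### Codimension two flats -/

section

variable {k : Type*} [Field k] {σ : Type*} [LinearOrder σ]

/-- A polynomial vanishing on all hyperplanes `x_a = x_b` with `a, b ∈ T` is divisible by the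
product of their linear forms. -/
theorem pairProd_X_dvd {T : Finset σ} {p : MvPolynomial σ k}
    (h : ∀ a ∈ T, ∀ b ∈ T, a ≠ b → replace a (X b) p = 0) : pairProd X T ∣ p := by
  induction T using Finset.induction_on generalizing p with
  | empty => simp [pairProd]
  | insert c T hc ih =>
    obtain ⟨q, rfl⟩ := prod_X_sub_X_dvd hc fun j hj =>
      h c (Finset.mem_insert_self c T) j (Finset.mem_insert_of_mem hj) fun e => hc (e ▸ hj)
    refine (pairProd_insert X hc).dvd.trans (mul_dvd_mul_left _ (ih fun a ha b hb hab => ?_))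
    have := h a (Finset.mem_insert_of_mem ha) b (Finset.mem_insert_of_mem hb) hab
    rw [map_mul, map_prod] at this
    refine (mul_eq_zero.mp this).resolve_left (Finset.prod_ne_zero_iff.mpr fun j _ => ?_)
    have hca : c ≠ a := fun e => hc (e ▸ ha)
    have hcb : c ≠ b := fun e => hc (e ▸ hb)
    rw [map_sub, replace_X_of_ne hca, sub_ne_zero]
    by_cases hja : j = a
    · rw [hja, replace_X_self]
      exact fun e => hcb (X_injective e)
    · rw [replace_X_of_ne hja]
      rintro e
      have : c = j := X_injective e
      exact hc (this ▸ ‹j ∈ T›)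

/-- The substitutions that restrict polynomials to the codimension two flats
`x_i = x_j = x_l`, or `x_i = x_j, x_l = x_r`, or `x_i = x_j = 0` with `i, j ∉ S`,
all indices being distinct elements of `T`. -/
def IsFlat (T S : Finset σ) (g : σ → MvPolynomial σ k) : Prop :=
  (∃ i ∈ T, ∃ j ∈ T, ∃ l ∈ T, i ≠ j ∧ i ≠ l ∧ j ≠ l ∧
    g = Function.update (Function.update X i (X l)) j (X l)) ∨
  (∃ i ∈ T, ∃ j ∈ T, ∃ l ∈ T, ∃ r ∈ T, i ≠ j ∧ i ≠ l ∧ i ≠ r ∧ j ≠ l ∧ j ≠ r ∧ l ≠ r ∧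
    g = Function.update (Function.update X i (X j)) l (X r)) ∨
  (∃ i ∈ T, ∃ j ∈ T, i ≠ j ∧ i ∉ S ∧ j ∉ S ∧
    g = Function.update (Function.update X i 0) j 0)

theorem IsFlat.mono {T T' S : Finset σ} {g : σ → MvPolynomial σ k} (h : IsFlat T' S g)
    (hT : T' ⊆ T) : IsFlat T S g := by
  rcases h with ⟨i, hi, j, hj, l, hl, h⟩ | ⟨i, hi, j, hj, l, hl, r, hr, h⟩ | ⟨i, hi, j, hj, h⟩
  · exact Or.inl ⟨i, hT hi, j, hT hj, l, hT hl, h⟩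
  · exact Or.inr (Or.inl ⟨i, hT hi, j, hT hj, l, hT hl, r, hT hr, h⟩)
  · exact Or.inr (Or.inr ⟨i, hT hi, j, hT hj, h⟩)

theorem IsFlat.eq_zero_or_X {T S : Finset σ} {g : σ → MvPolynomial σ k} (h : IsFlat T S g)
    (i : σ) : (g i = 0 ∧ i ∈ T ∧ i ∉ S) ∨ (∃ l ∈ T, i ∈ T ∧ g i = X l) ∨ g i = X i := by
  rcases h with ⟨a, ha, b, hb, c, hc, h1, h2, h3, rfl⟩ |
    ⟨a, ha, b, hb, c, hc, d, hd, h1, h2, h3, h4, h5, h6, rfl⟩ | ⟨a, ha, b, hb, h1, h2, h3, rfl⟩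
  all_goals simp only [Function.update_apply]; grind

theorem IsFlat.apply_eq {T S : Finset σ} {g : σ → MvPolynomial σ k} (h : IsFlat T S g)
    {i : σ} (hi : i ∉ T) : g i = X i := by
  have := h.eq_zero_or_X i
  tauto

theorem IsFlat.apply_ne_zero {T S : Finset σ} {g : σ → MvPolynomial σ k} (h : IsFlat T S g)
    {i : σ} (hi : i ∈ S) : g i ≠ 0 := by
  rcases h.eq_zero_or_X i with h | ⟨l, -, -, h⟩ | h
  · exact absurd hi h.2.2
  · rw [h]; exact X_ne_zero l
  · rw [h]; exact X_ne_zero i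

/-- Deleting one index, a flat still satisfies one of the equations `x_i = x_j`, unless it lies in
the coordinate hyperplane of the deleted index. -/
theorem IsFlat.exists_eq {T S : Finset σ} {g : σ → MvPolynomial σ k} (h : IsFlat T S g) (s : σ) :
    (s ∉ S ∧ g s = 0) ∨ ∃ i ∈ T.erase s, ∃ j ∈ T.erase s, i ≠ j ∧ g i = g j := by
  rcases h with ⟨a, ha, b, hb, c, hc, h1, h2, h3, rfl⟩ |
    ⟨a, ha, b, hb, c, hc, d, hd, h1, h2, h3, h4, h5, h6, rfl⟩ | ⟨a, ha, b, hb, h1, h2, h3, rfl⟩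
  · right
    by_cases hsa : s = a
    · exact ⟨b, by grind, c, by grind, h3, by simp [Function.update_apply]⟩
    · by_cases hsb : s = b
      · exact ⟨a, by grind, c, by grind, h2, by simp [Function.update_apply]⟩
      · exact ⟨a, by grind, b, by grind, h1, by simp [Function.update_apply]⟩
  · right
    by_cases hsa : s = a ∨ s = b
    · exact ⟨c, by grind, d, by grind, h6, by simp [Function.update_apply]; grind⟩
    · exact ⟨a, by grind, b, by grind, h1, by simp [Function.update_apply]; grind⟩
  · by_cases hsa : s = a
    · exact Or.inl ⟨by grind, by simp [Function.update_apply, hsa]⟩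
    · by_cases hsb : s = b
      · exact Or.inl ⟨by grind, by simp [hsb]⟩
      · exact Or.inr ⟨a, by grind, b, by grind, h1, by simp [Function.update_apply]⟩

/-- The product of the differences `x_i - x_j` over all pairs `i < j` in `T` avoiding `s`,
multiplied by `x_s` if `s ∉ S`. -/
noncomputable def flatGenerator (k : Type*) [Field k] (T S : Finset σ) (s : σ) :
    MvPolynomial σ k :=
  (if s ∈ S then 1 else X s) * pairProd X (T.erase s)

theorem aeval_pairProd_X (g : σ → MvPolynomial σ k) (T : Finset σ) :
    aeval g (pairProd X T : MvPolynomial σ k) = pairProd g T := by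
  refine (map_pairProd (aeval g : MvPolynomial σ k →ₐ[k] _).toRingHom X T).trans ?_
  exact pairProd_congr (R := MvPolynomial σ k) fun i _ => aeval_X g i

theorem IsFlat.aeval_flatGenerator {T S : Finset σ} {g : σ → MvPolynomial σ k}
    (h : IsFlat T S g) (s : σ) : aeval g (flatGenerator k T S s) = 0 := by
  rw [flatGenerator, map_mul]
  rcases h.exists_eq s with ⟨h1, h2⟩ | ⟨i, hi, j, hj, hij, e⟩
  · rw [if_neg h1, aeval_X, h2, zero_mul]
  · rw [aeval_pairProd_X, pairProd_eq_zero hi hj hij e, mul_zero]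

end

/-! ### Interpolation along one variable -/

section

variable {k : Type*} [Field k] {σ : Type*} [LinearOrder σ]

theorem replace_replace_eq_aeval {c a : σ} (b : MvPolynomial σ k) {d : MvPolynomial σ k}
    (h : replace a b d = d) (hca : c ≠ a) (p : MvPolynomial σ k) :
    replace a b (replace c d p) =
      aeval (Function.update (Function.update X c d) a b) p := by
  rw [replace, replace, ← AlgHom.comp_apply]
  refine congrArg (fun φ : MvPolynomial σ k →ₐ[k] MvPolynomial σ k => φ p) (algHom_ext fun i => ?_)
  rw [replace] at h
  rw [AlgHom.comp_apply, aeval_X, aeval_X]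
  by_cases hic : i = c
  · subst hic
    rw [Function.update_self, h, Function.update_of_ne hca, Function.update_self]
  · rw [Function.update_of_ne hic, aeval_X]
    by_cases hia : i = a
    · rw [hia, Function.update_self, Function.update_self]
    · rw [Function.update_of_ne hia, Function.update_of_ne hia, Function.update_of_ne hic]

/-- A polynomial vanishing on the codimension two flats restricts to the hyperplane `x_c = x_j` as
a multiple of the restriction of the `j`-th generator. -/
theorem dvd_replace_of_flat {T S : Finset σ} {c j : σ} (hc : c ∈ T) (hj : j ∈ T) (hcj : c ≠ j)
    (hS : c ∉ S ∨ j ∈ S) {h : MvPolynomial σ k}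
    (hh : ∀ g : σ → MvPolynomial σ k, IsFlat T S g → aeval g h = 0) :
    replace c (X j) (flatGenerator k T S j) ∣ replace c (X j) h := by
  have hjT : j ∉ (T.erase c).erase j := Finset.notMem_erase _ _
  have hmem : j ∈ T.erase c := Finset.mem_erase.mpr ⟨hcj.symm, hj⟩
  have hcj' : c ∈ T.erase j := Finset.mem_erase.mpr ⟨hcj, hc⟩
  -- Up to sign the generator restricts to `pairProd X (T.erase c)`, times `x_j` if `j ∉ S`.
  have hgen : Associated (replace c (X j) (flatGenerator k T S j))
      ((if j ∈ S then 1 else X j) * pairProd X (T.erase c)) := by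
    rw [flatGenerator, map_mul]
    have e1 : replace c (X j) (if j ∈ S then 1 else X j : MvPolynomial σ k) =
        if j ∈ S then 1 else X j := by
      split_ifs
      · exact map_one _
      · exact replace_X_of_ne hcj.symm _
    rw [e1]
    refine Associated.mul_left _ ?_
    have e2 : replace c (X j) (pairProd X (T.erase j)) =
        pairProd (Function.update X c (X j) : σ → MvPolynomial σ k) (T.erase j) := by
      exact aeval_pairProd_X _ _
    rw [e2]
    refine (pairProd_erase _ hcj').trans (Associated.trans ?_ (pairProd_erase _ hmem).symm)
    rw [Finset.erase_right_comm]
    refine Associated.of_eq ?_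
    congr 1
    · refine Finset.prod_congr rfl fun i hi => ?_
      rw [Function.update_self, Function.update_of_ne (by grind)]
    · exact pairProd_congr fun i hi => Function.update_of_ne (by grind) _ _
  refine hgen.dvd.trans ?_
  -- Each factor `x_a - x_b` comes from the flat `x_c = x_j, x_a = x_b`, a triple one if `j = a, b`.
  have hpair : pairProd X (T.erase c) ∣ replace c (X j) h := by
    refine pairProd_X_dvd fun a ha b hb hab => ?_
    have hca : c ≠ a := (Finset.ne_of_mem_erase ha).symm
    have hcb : c ≠ b := (Finset.ne_of_mem_erase hb).symm
    have haT := Finset.mem_of_mem_erase ha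
    have hbT := Finset.mem_of_mem_erase hb
    by_cases hja : j = a
    · subst hja
      have e : replace j (X b) (replace c (X j) h) =
          aeval (Function.update (Function.update X c (X b)) j (X b)) h := by
        rw [← replace_replace_eq_aeval (X b) (replace_X_of_ne hab.symm _) hca]
        simp only [replace, ← AlgHom.comp_apply]
        refine congrArg (fun φ : MvPolynomial σ k →ₐ[k] MvPolynomial σ k => φ h)
          (algHom_ext fun i => ?_)
        by_cases hic : i = c
        · subst hic
          simp [Function.update_of_ne hab.symm]
        · simp [Function.update_of_ne hic]
      rw [e]
      exact hh _ (Or.inl ⟨c, hc, j, haT, b, hbT, hca, hcb, hab, rfl⟩)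
    · rw [replace_replace_eq_aeval _ (replace_X_of_ne hja _) hca]
      by_cases hjb : j = b
      · subst hjb
        exact hh _ (Or.inl ⟨c, hc, a, haT, j, hbT, hca, hcb, hab, rfl⟩)
      · exact hh _ (Or.inr (Or.inl ⟨c, hc, j, hj, a, haT, b, hbT, hcj, hca, hcb, hja, hjb, hab,
          rfl⟩))
  split_ifs with hjS
  · rwa [one_mul]
  · -- When `j ∉ S`, the flat `x_c = x_j = 0` shows that `x_j` is one more prime factor.
    obtain ⟨q, hq⟩ := hpair
    have h0 : replace j 0 (replace c (X j) h) = 0 := by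
      have e : replace j 0 (replace c (X j) h) =
          aeval (Function.update (Function.update X c 0) j 0) h := by
        rw [← replace_replace_eq_aeval 0 (map_zero _) hcj]
        simp only [replace, ← AlgHom.comp_apply]
        refine congrArg (fun φ : MvPolynomial σ k →ₐ[k] MvPolynomial σ k => φ h)
          (algHom_ext fun i => ?_)
        by_cases hic : i = c
        · subst hic
          simp
        · simp [Function.update_of_ne hic]
      rw [e]
      exact hh _ (Or.inr (Or.inr ⟨c, hc, j, hj, hcj, hS.resolve_right hjS, hjS, rfl⟩))
    rw [hq, map_mul] at h0
    have h1 : replace j 0 (pairProd X (T.erase c) : MvPolynomial σ k) ≠ 0 := by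
      refine fun e => ?_
      have e' : pairProd (Function.update X j 0 : σ → MvPolynomial σ k) (T.erase c) = 0 :=
        (aeval_pairProd_X (Function.update X j 0) (T.erase c)).symm.trans e
      simp only [pairProd, Finset.prod_eq_zero_iff] at e'
      obtain ⟨a, -, b, -, e'⟩ := e'
      split_ifs at e' with hab
      · rw [sub_eq_zero] at e'
        by_cases haj : a = j
        · subst haj
          rw [Function.update_self, Function.update_of_ne hab.ne'] at e'
          exact X_ne_zero _ e'.symm
        · rw [Function.update_of_ne haj] at e'
          by_cases hbj : b = j
          · subst hbj
            rw [Function.update_self] at e'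
            exact X_ne_zero _ e'
          · rw [Function.update_of_ne hbj] at e'
            exact hab.ne (X_injective e')
      · exact one_ne_zero e'
    have hdvd : X j ∣ q := by
      simpa using X_sub_dvd_of_replace_eq_zero ((mul_eq_zero.mp h0).resolve_left h1)
    rw [hq, mul_comm (X j)]
    exact mul_dvd_mul_left _ hdvd

/-- A flat not involving `c` lies on none of the hyperplanes `x_c = x_j`. -/
theorem IsFlat.aeval_prod_ne_zero {T S : Finset σ} {c : σ} {g : σ → MvPolynomial σ k}
    (h : IsFlat (T.erase c) S g) :
    aeval g (∏ j ∈ T.erase c, (X c - X j) : MvPolynomial σ k) ≠ 0 := by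
  rw [map_prod, Finset.prod_ne_zero_iff]
  intro j hj
  rw [map_sub, aeval_X, aeval_X, h.apply_eq (Finset.notMem_erase c T), sub_ne_zero]
  rcases h.eq_zero_or_X j with ⟨e, -⟩ | ⟨l, hl, -, e⟩ | e
  · rw [e]; exact X_ne_zero c
  · rw [e]; exact fun e' => (Finset.ne_of_mem_erase hl) (X_injective e').symm
  · rw [e]; exact fun e' => (Finset.ne_of_mem_erase hj) (X_injective e').symm

/-- The product `∏ (x_c - x_j)` carries the generators for `T.erase c` into the span of those
for `T`. -/
theorem prod_mul_flatGenerator_erase {T : Finset σ} (S : Finset σ) {c s : σ} (hc : c ∈ T)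
    (hs : s ∈ T.erase c) :
    Associated ((∏ j ∈ T.erase c, (X c - X j)) * flatGenerator k (T.erase c) S s)
      ((X c - X s) * flatGenerator k T S s) := by
  have hcs : c ∈ T.erase s := by grind
  rw [← Finset.mul_prod_erase _ _ hs, flatGenerator, flatGenerator]
  have h := pairProd_erase (X : σ → MvPolynomial σ k) hcs
  rw [Finset.erase_right_comm (a := s)] at h
  refine Associated.trans (Associated.of_eq ?_)
    ((h.symm.mul_left (if s ∈ S then 1 else X s)).mul_left (X c - X s))
  ring

/-- A polynomial vanishing on all the codimension two flats with indices in `T` lies in the ideal of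
the generators. Interpolation along one variable `x_c` writes it as a combination of generators
plus a multiple of `∏ (x_c - x_j)`, and the cofactor vanishes on the flats avoiding `c`. -/
theorem mem_span_flatGenerator {T S : Finset σ} (hT : 2 ≤ T.card) {h : MvPolynomial σ k}
    (hh : ∀ g : σ → MvPolynomial σ k, IsFlat T S g → aeval g h = 0) :
    h ∈ Ideal.span (flatGenerator k T S '' (T : Set σ)) := by
  induction hN : T.card using Nat.strong_induction_on generalizing T h with
  | _ N ih =>
  -- With `c ∉ S`, the flats `x_c = x_j = 0` are available for all `j ∉ S`.
  obtain ⟨c, hc, hS⟩ : ∃ c ∈ T, c ∉ S ∨ T ⊆ S := by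
    by_cases hTS : T ⊆ S
    · obtain ⟨c, hc⟩ := Finset.card_pos.mp (show 0 < T.card by omega)
      exact ⟨c, hc, Or.inr hTS⟩
    · obtain ⟨c, hc, hcS⟩ := Finset.not_subset.mp hTS
      exact ⟨c, hc, Or.inl hcS⟩
  have hgenmem : ∀ s ∈ T, flatGenerator k T S s ∈
      Ideal.span (flatGenerator k T S '' (T : Set σ)) := fun s hs =>
    Ideal.subset_span ⟨s, hs, rfl⟩
  have hdiv : ∀ j ∈ T.erase c, ∃ r, replace c (X j) h =
      replace c (X j) (flatGenerator k T S j * r) := by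
    intro j hj
    have hjc := Finset.ne_of_mem_erase hj
    have hjT := Finset.mem_of_mem_erase hj
    obtain ⟨r, hr⟩ := dvd_replace_of_flat hc hjT hjc.symm
      (hS.imp_right fun h => h hjT) hh
    refine ⟨r, ?_⟩
    have hidem : ∀ p : MvPolynomial σ k,
        replace c (X j) (replace c (X j) p) = replace c (X j) p := fun p => by
      have h1 := (X_sub_X_dvd_iff hjc.symm).mp (X_sub_dvd_sub_replace c (X j) p)
      rw [map_sub, sub_eq_zero] at h1
      exact h1.symm
    -- The cofactor may involve `x_c`; restricting once more replaces it by its restriction.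
    rw [← hidem, hr, map_mul, hidem, map_mul]
  choose! r hr using hdiv
  -- The generators with index `i ≠ c, j` contain the factor `x_c - x_j`.
  have hvan : ∀ j ∈ T.erase c,
      replace c (X j) (h - ∑ i ∈ T.erase c, flatGenerator k T S i * r i) = 0 := by
    intro j hj
    rw [map_sub, map_sum, Finset.sum_eq_single_of_mem j hj, hr j hj, sub_self]
    intro i hi hij
    rw [map_mul, flatGenerator, map_mul]
    have e : replace c (X j) (pairProd X (T.erase i) : MvPolynomial σ k) = 0 := by
      refine (aeval_pairProd_X _ _).trans
        (pairProd_eq_zero (i := c) (j := j) (by grind) (by grind) (by grind) ?_)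
      rw [Function.update_self, Function.update_of_ne (by grind)]
    rw [e, mul_zero, zero_mul]
  obtain ⟨q, hq⟩ := prod_X_sub_X_dvd (Finset.notMem_erase c T) hvan
  rw [sub_eq_iff_eq_add] at hq
  have hsum : ∑ i ∈ T.erase c, flatGenerator k T S i * r i ∈
      Ideal.span (flatGenerator k T S '' (T : Set σ)) :=
    Ideal.sum_mem _ fun i hi => Ideal.mul_mem_right _ _ (hgenmem i (Finset.mem_of_mem_erase hi))
  rw [hq]
  refine Ideal.add_mem _ ?_ hsum
  have hcard : (T.erase c).card + 1 = T.card := Finset.card_erase_add_one hc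
  rcases hT.eq_or_lt with h2 | h3
  · -- For two indices the product itself is a combination of the generators.
    obtain ⟨j, hj⟩ := Finset.card_eq_one.mp (show (T.erase c).card = 1 by omega)
    have hjT : j ∈ T := Finset.mem_of_mem_erase (hj ▸ Finset.mem_singleton_self j)
    have hjc : j ≠ c := Finset.ne_of_mem_erase (hj ▸ Finset.mem_singleton_self j)
    have hgen1 : ∀ s ∈ T, X s ∈ Ideal.span (flatGenerator k T S '' (T : Set σ)) := by
      intro s hs
      have e : pairProd (X : σ → MvPolynomial σ k) (T.erase s) = 1 := by
        obtain ⟨t, ht⟩ := Finset.card_eq_one.mp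
          (show (T.erase s).card = 1 by rw [Finset.card_erase_of_mem hs]; omega)
        simp [pairProd, ht]
      have := hgenmem s hs
      rw [flatGenerator, e, mul_one] at this
      split_ifs at this
      · rw [(Ideal.eq_top_iff_one _).mpr this]; trivial
      · exact this
    rw [hj, Finset.prod_singleton]
    exact Ideal.mul_mem_right _ _ (Ideal.sub_mem _ (hgen1 c hc) (hgen1 j hjT))
  · have hqmem := ih (T.erase c).card (by omega) (T := T.erase c) (h := q) (by omega)
      (fun g hg => by
      have h1 := hh g (hg.mono (Finset.erase_subset c T))
      rw [hq, map_add, map_sum, map_mul, Finset.sum_eq_zero, add_zero] at h1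
      · exact (mul_eq_zero.mp h1).resolve_left hg.aeval_prod_ne_zero
      · intro i _
        rw [map_mul, (hg.mono (Finset.erase_subset c T)).aeval_flatGenerator, zero_mul]) rfl
    clear hq hvan hh
    induction hqmem using Submodule.span_induction with
    | mem x hx =>
      obtain ⟨s, hs, rfl⟩ := hx
      refine Ideal.mem_of_dvd _ (prod_mul_flatGenerator_erase S hc hs).symm.dvd ?_
      exact Ideal.mul_mem_left _ _ (hgenmem s (Finset.mem_of_mem_erase hs))
    | zero => rw [mul_zero]; exact Ideal.zero_mem _
    | add x y _ _ hx hy => rw [mul_add]; exact Ideal.add_mem _ hx hy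
    | smul a x _ hx => rw [smul_eq_mul, mul_left_comm]; exact Ideal.mul_mem_left _ _ hx

end

/-! ### Decomposition by exponents modulo `m` -/

section

variable {σ : Type*}

/-- The substitution `x_i ↦ u_i x_i`. -/
noncomputable def scale (u : σ → ℂ) : MvPolynomial σ ℂ →ₐ[ℂ] MvPolynomial σ ℂ :=
  aeval fun i => C (u i) * X i

theorem scale_X (u : σ → ℂ) (i : σ) : scale u (X i) = C (u i) * X i := aeval_X _ _

theorem scale_expand {m : ℕ} {u : σ → ℂ} (hu : ∀ i, u i ^ m = 1) (h : MvPolynomial σ ℂ) :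
    scale u (expand m h) = expand m h := by
  rw [← AlgHom.comp_apply]
  refine congrArg (fun φ : MvPolynomial σ ℂ →ₐ[ℂ] MvPolynomial σ ℂ => φ h)
    (algHom_ext fun i => ?_)
  rw [AlgHom.comp_apply, expand_X, map_pow, scale_X, mul_pow, ← C_pow, hu, C_1, one_mul]

variable [Fintype σ]

/-- The polynomial whose exponents are the reduced residues `e` modulo `m`, up to `m`-th powers:
`x ^ e * h(x ^ m)`. -/
noncomputable def residueTerm {m : ℕ} (e : σ → Fin m) (h : MvPolynomial σ ℂ) :
    MvPolynomial σ ℂ :=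
  (∏ i, X i ^ (e i : ℕ)) * expand m h

theorem exists_eq_sum_residueTerm [DecidableEq σ] {m : ℕ} (hm : 0 < m) (f : MvPolynomial σ ℂ) :
    ∃ h : (σ → Fin m) → MvPolynomial σ ℂ, f = ∑ e, residueTerm e (h e) := by
  induction f using MvPolynomial.induction_on' with
  | monomial s c =>
    let e : σ → Fin m := fun i => ⟨s i % m, Nat.mod_lt _ hm⟩
    refine ⟨Pi.single e (monomial (s.mapRange (· / m) (Nat.zero_div m)) c), ?_⟩
    rw [Finset.sum_eq_single e]
    · rw [Pi.single_eq_same, residueTerm, monomial_eq, monomial_eq, map_mul, expand_C,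
        Finsupp.prod_fintype, Finsupp.prod_fintype, map_prod, mul_left_comm,
        ← Finset.prod_mul_distrib]
      · congr 1
        refine Finset.prod_congr rfl fun i _ => ?_
        rw [map_pow, expand_X, ← pow_mul, ← pow_add]
        exact congrArg _ (Nat.mod_add_div _ _).symm
      all_goals simp
    · intro b _ hb
      rw [Pi.single_eq_of_ne hb, residueTerm, map_zero, mul_zero]
    · simp
  | add p q hp hq =>
    obtain ⟨h, hh⟩ := hp
    obtain ⟨h', hh'⟩ := hq
    refine ⟨h + h', ?_⟩
    conv_lhs => rw [hh, hh']
    simp only [residueTerm, Pi.add_apply, map_add, mul_add, Finset.sum_add_distrib]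

theorem scale_residueTerm {m : ℕ} {u : σ → ℂ} (hu : ∀ i, u i ^ m = 1) (e : σ → Fin m)
    (h : MvPolynomial σ ℂ) :
    scale u (residueTerm e h) = C (∏ i, u i ^ (e i : ℕ)) * residueTerm e h := by
  rw [residueTerm, map_mul, scale_expand hu, map_prod, ← mul_assoc, map_prod,
    ← Finset.prod_mul_distrib]
  congr 1
  refine Finset.prod_congr rfl fun i _ => ?_
  rw [map_pow, scale_X, mul_pow, C_pow]

/-- Orthogonality of the characters `t ↦ ∏ ζ ^ (t_i e_i)` of `(ℤ/m)^σ`. -/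
theorem sum_prod_root_pow [DecidableEq σ] {m : ℕ} {ζ : ℂ} (hζ : IsPrimitiveRoot ζ m)
    (e e' : σ → Fin m) :
    ∑ t : σ → Fin m, ∏ i, (ζ ^ (m - (e i : ℕ) + (e' i : ℕ))) ^ (t i : ℕ) =
      if e' = e then (m : ℂ) ^ Fintype.card σ else 0 := by
  have hsum := (Finset.prod_univ_sum (fun _ : σ => (Finset.univ : Finset (Fin m)))
    (fun i a => (ζ ^ (m - (e i : ℕ) + (e' i : ℕ))) ^ (a : ℕ))).symm
  rw [Fintype.piFinset_univ] at hsum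
  rw [hsum]
  split_ifs with h
  · subst h
    have h1 : ∀ i, ζ ^ (m - (e' i : ℕ) + (e' i : ℕ)) = 1 := fun i => by
      rw [Nat.sub_add_cancel (e' i).2.le, hζ.pow_eq_one]
    simp only [h1, one_pow, Finset.sum_const, Finset.prod_const, Finset.card_univ, Fintype.card_fin,
      nsmul_eq_mul, mul_one]
  · obtain ⟨i, hi⟩ := Function.ne_iff.mp h
    refine Finset.prod_eq_zero (Finset.mem_univ i) ?_
    set q := ζ ^ (m - (e i : ℕ) + (e' i : ℕ)) with hq
    have hqm : q ^ m = 1 := by rw [hq, ← pow_mul, mul_comm, pow_mul, hζ.pow_eq_one, one_pow]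
    have hq1 : q ≠ 1 := by
      rw [hq, Ne, hζ.pow_eq_one_iff_dvd]
      rintro ⟨c, hc⟩
      have h1 := (e i).2
      have h2 := (e' i).2
      have h3 : (e' i : ℕ) ≠ e i := fun h => hi (Fin.ext h)
      rcases Nat.lt_or_ge c 1 with hc1 | hc1
      · have : c = 0 := by omega
        subst this; omega
      · rcases Nat.lt_or_ge c 2 with hc2 | hc2
        · have : c = 1 := by omega
          subst this; omega
        · have := Nat.mul_le_mul_left m hc2
          omega
    rw [Fin.sum_univ_eq_sum_range (fun a => q ^ a)]
    have := mul_neg_geom_sum q m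
    rw [hqm, sub_self] at this
    exact (mul_eq_zero.mp this).resolve_left (sub_ne_zero.mpr hq1.symm)

/-- An ideal stable under the torus of `m`-th roots of unity contains, with a polynomial, all its
residue components. -/
theorem residueTerm_mem [DecidableEq σ] {m : ℕ} (hm : 0 < m) {K : Ideal (MvPolynomial σ ℂ)}
    (hK : ∀ u : σ → ℂ, (∀ i, u i ^ m = 1) → ∀ f ∈ K, scale u f ∈ K)
    {h : (σ → Fin m) → MvPolynomial σ ℂ} (hh : ∑ e, residueTerm e (h e) ∈ K) (e : σ → Fin m) :
    residueTerm e (h e) ∈ K := by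
  have hζ := Complex.isPrimitiveRoot_exp m hm.ne'
  set ζ := Complex.exp (2 * Real.pi * Complex.I / m)
  have hroot : ∀ (t : σ → Fin m) (i : σ), (ζ ^ (t i : ℕ)) ^ m = 1 := fun t i => by
    rw [← pow_mul, mul_comm, pow_mul, hζ.pow_eq_one, one_pow]
  have hmem : ∑ t : σ → Fin m, C (∏ i, (ζ ^ (m - (e i : ℕ))) ^ (t i : ℕ)) *
      scale (fun i => ζ ^ (t i : ℕ)) (∑ e', residueTerm e' (h e')) ∈ K :=
    Ideal.sum_mem _ fun t _ => Ideal.mul_mem_left _ _ (hK _ (hroot t) _ hh)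
  -- Averaging over the torus against the character `e` isolates the component `e`.
  have key : ∑ t : σ → Fin m, C (∏ i, (ζ ^ (m - (e i : ℕ))) ^ (t i : ℕ)) *
      scale (fun i => ζ ^ (t i : ℕ)) (∑ e', residueTerm e' (h e')) =
      C ((m : ℂ) ^ Fintype.card σ) * residueTerm e (h e) := by
    simp only [map_sum, scale_residueTerm (hroot _), Finset.mul_sum]
    rw [Finset.sum_comm]
    have : ∀ e' : σ → Fin m, ∑ t : σ → Fin m, C (∏ i, (ζ ^ (m - (e i : ℕ))) ^ (t i : ℕ)) *
        (C (∏ i, (ζ ^ (t i : ℕ)) ^ (e' i : ℕ)) * residueTerm e' (h e')) =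
        C (if e' = e then (m : ℂ) ^ Fintype.card σ else 0) * residueTerm e' (h e') := by
      intro e'
      rw [← sum_prod_root_pow hζ, map_sum, Finset.sum_mul]
      refine Finset.sum_congr rfl fun t _ => ?_
      rw [← mul_assoc, ← C_mul, ← Finset.prod_mul_distrib]
      congr 2
      refine Finset.prod_congr rfl fun i _ => ?_
      rw [pow_add, mul_pow, pow_right_comm ζ (e' i : ℕ)]
    simp only [this]
    rw [Finset.sum_eq_single e]
    · rw [if_pos rfl]
    · intro b _ hb
      rw [if_neg hb, C_0, zero_mul]
    · simp
  rw [key] at hmem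
  have hne : (m : ℂ) ^ Fintype.card σ ≠ 0 := pow_ne_zero _ (Nat.cast_ne_zero.mpr hm.ne')
  have := Ideal.mul_mem_left _ (C ((m : ℂ) ^ Fintype.card σ)⁻¹) hmem
  rwa [← mul_assoc, ← C_mul, inv_mul_cancel₀ hne, C_1, one_mul] at this

theorem eq_zero_of_residueTerm_eq_zero {m : ℕ} (hm : 0 < m) {e : σ → Fin m}
    {h : MvPolynomial σ ℂ} (hh : residueTerm e h = 0) : h = 0 := by
  rcases mul_eq_zero.mp hh with h0 | h0
  · exact absurd h0 (Finset.prod_ne_zero_iff.mpr fun i _ => pow_ne_zero _ (X_ne_zero i))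
  · exact (expand_eq_zero hm).mp h0

theorem eq_zero_of_sum_residueTerm_eq_zero [DecidableEq σ] {m : ℕ} (hm : 0 < m)
    {h : (σ → Fin m) → MvPolynomial σ ℂ} (hh : ∑ e, residueTerm e (h e) = 0) (e : σ → Fin m) :
    h e = 0 := by
  refine eq_zero_of_residueTerm_eq_zero hm (residueTerm_mem hm (K := ⊥) ?_ hh e)
  rintro u - f hf
  rw [Ideal.mem_bot] at hf ⊢
  rw [hf, map_zero]

end

/-! ### The ideal of the generators is radical -/

theorem monomialGenerator_eq (m n : ℕ) (s : Fin (n + 1)) :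
    monomialGenerator m n s = X s * pairProd (fun i => X i ^ m) (Finset.univ.erase s) := by
  rw [monomialGenerator, pairProd, ← Finset.prod_product', ← Finset.prod_filter]
  congr 1
  refine Finset.prod_congr ?_ fun _ _ => rfl
  ext p
  simp only [Finset.mem_filter, Finset.mem_product, Finset.mem_erase, Finset.mem_univ, true_and,
    and_true]
  tauto

theorem scale_monomialGenerator {m n : ℕ} {u : Fin (n + 1) → ℂ} (hu : ∀ i, u i ^ m = 1)
    (s : Fin (n + 1)) : scale u (monomialGenerator m n s) = C (u s) * monomialGenerator m n s := by
  rw [monomialGenerator, map_mul, scale_X, mul_assoc, map_prod]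
  refine congrArg _ (congrArg _ (Finset.prod_congr rfl fun p _ => ?_))
  simp only [map_sub, map_pow, scale_X, mul_pow, ← C_pow, hu, C_1, one_mul]

theorem IsFlat.aeval_monomialGenerator {m n : ℕ} {T S : Finset (Fin (n + 1))}
    {g : Fin (n + 1) → MvPolynomial (Fin (n + 1)) ℂ} (h : IsFlat T S g)
    (s : Fin (n + 1)) : aeval g (monomialGenerator m n s) = 0 := by
  rw [monomialGenerator_eq, map_mul, aeval_X]
  rcases h.exists_eq s with ⟨-, h2⟩ | ⟨i, hi, j, hj, hij, e⟩
  · rw [h2, zero_mul]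
  · have := map_pairProd (aeval g : MvPolynomial (Fin (n + 1)) ℂ →ₐ[ℂ] _).toRingHom
      (fun i => X i ^ m) (Finset.univ.erase s)
    have hz : aeval g (pairProd (fun i => X i ^ m : Fin (n + 1) → MvPolynomial (Fin (n + 1)) ℂ)
        (Finset.univ.erase s)) = 0 := by
      refine this.trans (pairProd_eq_zero (i := i) (j := j) (by grind) (by grind) hij ?_)
      change aeval g (X i ^ m) = aeval g (X j ^ m)
      rw [map_pow, map_pow, aeval_X, aeval_X, e]
    rw [hz, mul_zero]

theorem IsFlat.aeval_expand {σ : Type*} [LinearOrder σ] {m : ℕ} (hm : m ≠ 0) {T S : Finset σ}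
    {g : σ → MvPolynomial σ ℂ} (h : IsFlat T S g) (p : MvPolynomial σ ℂ) :
    aeval g (expand m p) = expand m (aeval g p) := by
  rw [← AlgHom.comp_apply, ← AlgHom.comp_apply]
  refine congrArg (fun φ : MvPolynomial σ ℂ →ₐ[ℂ] MvPolynomial σ ℂ => φ p)
    (algHom_ext fun i => ?_)
  rw [AlgHom.comp_apply, AlgHom.comp_apply, expand_X, map_pow, aeval_X]
  rcases h.eq_zero_or_X i with ⟨e, -⟩ | ⟨l, -, -, e⟩ | e
  · rw [e, zero_pow hm, map_zero]
  · rw [e, expand_X]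
  · rw [e, expand_X]

/-- With `S` the support of `e`, the generators of the flats in the variables `x_i ^ m` become
multiples of the `monomialGenerator`s after multiplication by `x ^ e`: the missing factor `x_s` is
supplied by `x ^ e` if `s ∈ S` and by `x_s ^ m` otherwise. -/
theorem residueTerm_flatGenerator_mem {m n : ℕ} (hm : 0 < m) (e : Fin (n + 1) → Fin m)
    (s : Fin (n + 1)) :
    residueTerm e (flatGenerator ℂ Finset.univ (Finset.univ.filter fun i => (e i : ℕ) ≠ 0) s) ∈
      Ideal.span (Set.range (monomialGenerator m n)) := by
  refine Ideal.mem_of_dvd _ ?_ (Ideal.subset_span ⟨s, rfl⟩)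
  rw [monomialGenerator_eq, residueTerm, flatGenerator, map_mul, ← mul_assoc]
  have h1 : expand m (pairProd X (Finset.univ.erase s) : MvPolynomial (Fin (n + 1)) ℂ) =
      pairProd (fun i => X i ^ m) (Finset.univ.erase s) := by
    refine (map_pairProd (expand m : MvPolynomial (Fin (n + 1)) ℂ →ₐ[ℂ] _).toRingHom X _).trans ?_
    exact pairProd_congr (R := MvPolynomial (Fin (n + 1)) ℂ) fun i _ => expand_X m i
  rw [h1]
  refine mul_dvd_mul_right ?_ _
  by_cases hs : (e s : ℕ) = 0
  · rw [if_neg (by simp [hs]), expand_X]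
    exact (dvd_pow_self _ hm.ne').mul_left _
  · have h2 : (X s : MvPolynomial (Fin (n + 1)) ℂ) ^ (e s : ℕ) ∣ ∏ i, X i ^ (e i : ℕ) :=
      Finset.dvd_prod_of_mem (fun i => (X i : MvPolynomial (Fin (n + 1)) ℂ) ^ (e i : ℕ))
        (Finset.mem_univ s)
    exact ((dvd_pow_self _ hs).trans h2).mul_right _

/-- The ideal of the generators is radical. Both the ideal and its radical split into residue
components, and a component of the radical vanishes on all the relevant flats. -/
theorem radical_span_monomialGenerator {m n : ℕ} (hm : 0 < m) (hn : 1 ≤ n) :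
    (Ideal.span (Set.range (monomialGenerator m n))).radical =
      Ideal.span (Set.range (monomialGenerator m n)) := by
  refine le_antisymm (fun f hf => ?_) Ideal.le_radical
  set I := Ideal.span (Set.range (monomialGenerator m n)) with hI
  have hstable : ∀ u : Fin (n + 1) → ℂ, (∀ i, u i ^ m = 1) → ∀ f ∈ I.radical,
      scale u f ∈ I.radical := by
    rintro u hu f ⟨N, hN⟩
    refine ⟨N, ?_⟩
    rw [← map_pow]
    have hle : I ≤ I.comap (scale u) := by
      rw [hI, Ideal.span_le]
      rintro _ ⟨s, rfl⟩
      change scale u (monomialGenerator m n s) ∈ I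
      rw [scale_monomialGenerator hu]
      exact Ideal.mul_mem_left _ _ (Ideal.subset_span ⟨s, rfl⟩)
    exact hle hN
  obtain ⟨h, rfl⟩ := exists_eq_sum_residueTerm hm f
  refine Ideal.sum_mem _ fun e _ => ?_
  have he := residueTerm_mem hm hstable hf e
  have hspan := mem_span_flatGenerator (k := ℂ) (T := Finset.univ)
    (S := Finset.univ.filter fun i => (e i : ℕ) ≠ 0) (h := h e)
    (by rw [Finset.card_univ, Fintype.card_fin]; omega) (fun g hg => by
      have hle : I ≤ RingHom.ker (aeval g : MvPolynomial (Fin (n + 1)) ℂ →ₐ[ℂ] _) := by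
        rw [hI, Ideal.span_le]
        rintro _ ⟨s, rfl⟩
        exact hg.aeval_monomialGenerator s
      have hz : aeval g (residueTerm e (h e)) = 0 :=
        ((RingHom.ker_isPrime _).radical_le_iff.mpr hle) he
      rw [residueTerm, map_mul, hg.aeval_expand hm.ne', map_prod] at hz
      refine (expand_eq_zero hm).mp ((mul_eq_zero.mp hz).resolve_left
        (Finset.prod_ne_zero_iff.mpr fun i _ => ?_))
      rw [map_pow, aeval_X]
      by_cases hi : (e i : ℕ) = 0
      · rw [hi, pow_zero]; exact one_ne_zero
      · exact pow_ne_zero _ (hg.apply_ne_zero (by simpa using hi)))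
  generalize h e = p at hspan
  induction hspan using Submodule.span_induction with
  | mem x hx =>
    obtain ⟨s, -, rfl⟩ := hx
    exact residueTerm_flatGenerator_mem hm e s
  | zero => rw [residueTerm, map_zero, mul_zero]; exact Ideal.zero_mem _
  | add x y _ _ hx hy =>
    rw [residueTerm, map_add, mul_add]; exact Ideal.add_mem _ hx hy
  | smul a x _ hx =>
    rw [residueTerm, smul_eq_mul, map_mul, mul_left_comm]; exact Ideal.mul_mem_left _ _ hx

/-! ### Maximal minors -/

theorem span_range_eq_of_associated {R ι : Type*} [CommRing R] {a b : ι → R}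
    (h : ∀ i, Associated (a i) (b i)) : Ideal.span (Set.range a) = Ideal.span (Set.range b) := by
  refine le_antisymm (Ideal.span_le.mpr ?_) (Ideal.span_le.mpr ?_)
  · rintro _ ⟨i, rfl⟩
    exact Ideal.mem_of_dvd _ (h i).symm.dvd (Ideal.subset_span ⟨i, rfl⟩)
  · rintro _ ⟨i, rfl⟩
    exact Ideal.mem_of_dvd _ (h i).dvd (Ideal.subset_span ⟨i, rfl⟩)

theorem exists_eq_succAboveOrderEmb {n : ℕ} (r : Fin n ↪o Fin (n + 1)) :
    ∃ s, r = Fin.succAboveOrderEmb s := by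
  have hcard : (Finset.univ.map r.toEmbedding)ᶜ.card = 1 := by
    rw [Finset.card_compl, Finset.card_map, Finset.card_univ, Fintype.card_fin, Fintype.card_fin,
      Nat.add_sub_cancel_left]
  obtain ⟨s, hs⟩ := Finset.card_eq_one.mp hcard
  refine ⟨s, ?_⟩
  rw [← Finset.orderEmbOfFin_compl_singleton_eq_succAboveOrderEmb]
  refine RelEmbedding.ext fun i => ?_
  refine congrFun (Finset.orderEmbOfFin_unique _ (fun i => ?_) r.strictMono) i
  rw [← hs, compl_compl]
  exact Finset.mem_map_of_mem _ (Finset.mem_univ i)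

theorem minorsIdeal_eq_span {R : Type*} [CommRing R] {n : ℕ}
    (M : Matrix (Fin (n + 1)) (Fin n) R) :
    minorsIdeal n M =
      Ideal.span (Set.range fun s : Fin (n + 1) => (M.submatrix s.succAbove id).det) := by
  rw [minorsIdeal]
  congr 1
  ext d
  constructor
  · rintro ⟨r, c, rfl⟩
    obtain ⟨s, rfl⟩ := exists_eq_succAboveOrderEmb r
    have hc : (c : Fin n → Fin n) = id := c.strictMono.eq_id
    refine ⟨s, ?_⟩
    rw [hc]
    rfl
  · rintro ⟨s, rfl⟩
    exact ⟨Fin.succAboveOrderEmb s, RelEmbedding.refl _, rfl⟩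

theorem associated_det_vandermonde {R : Type*} [CommRing R] {n : ℕ} (y : Fin (n + 1) → R)
    (s : Fin (n + 1)) :
    Associated (Matrix.vandermonde fun i => y (s.succAbove i)).det
      (pairProd y (Finset.univ.erase s)) := by
  have h : Finset.univ.erase s = Finset.univ.map s.succAboveEmb := by
    ext i
    simp [Fin.exists_succAbove_eq_iff]
  rw [Matrix.det_vandermonde, pairProd, h]
  simp only [Finset.prod_map, Fin.coe_succAboveEmb, Fin.succAbove_lt_succAbove_iff]
  refine Associated.prod _ _ _ fun i _ => ?_
  rw [← Finset.prod_filter, ← Finset.filter_lt_eq_Ioi]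
  refine Associated.prod _ _ _ fun j _ => ?_
  rw [← neg_sub]
  exact (Associated.refl _).neg_left

theorem X_mul_monomialMatrix {m n : ℕ} (hm : 0 < m) (i : Fin (n + 1)) (j : Fin n) :
    X i * monomialMatrix m n i j =
      (if (j : ℕ) = 0 then ∏ k, X k else 1) * (X i ^ m) ^ (j : ℕ) := by
  rw [monomialMatrix, Matrix.of_apply]
  split_ifs with hj
  · rw [hj, pow_zero, mul_one, Finset.mul_prod_erase _ _ (Finset.mem_univ i)]
  · rw [one_mul, ← pow_succ', ← pow_mul, mul_comm m]
    have := Nat.mul_pos (Nat.pos_of_ne_zero hj) hm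
    congr 1
    omega

/-- Multiplying the rows of a maximal minor by the respective variables turns it into a
Vandermonde determinant, up to the factor `∏ x_k` in the first column. -/
theorem associated_det_monomialMatrix {m n : ℕ} (hm : 0 < m) (hn : 1 ≤ n) (s : Fin (n + 1)) :
    Associated ((monomialMatrix m n).submatrix s.succAbove id).det (monomialGenerator m n s) := by
  obtain ⟨k, rfl⟩ : ∃ k, n = k + 1 := ⟨n - 1, by omega⟩
  -- The row factors multiply to `∏_{k ≠ s} x_k`, the column factor is `∏ x_k`.
  have hP : (∏ i, X (s.succAbove i) : MvPolynomial (Fin (k + 1 + 1)) ℂ) ≠ 0 :=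
    Finset.prod_ne_zero_iff.mpr fun i _ => X_ne_zero _
  have hrow : (∏ i, X (s.succAbove i)) *
      ((monomialMatrix m (k + 1)).submatrix s.succAbove id).det =
      (∏ i, X (s.succAbove i)) *
        (X s * (Matrix.vandermonde fun i => (X (s.succAbove i) ^ m :
          MvPolynomial (Fin (k + 1 + 1)) ℂ)).det) := by
    rw [← Matrix.det_mul_column]
    simp only [Matrix.submatrix_apply, id, X_mul_monomialMatrix hm]
    have h := Matrix.det_mul_row
      (fun j : Fin (k + 1) => (if (j : ℕ) = 0 then ∏ k, X k else 1 :
        MvPolynomial (Fin (k + 1 + 1)) ℂ))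
      (Matrix.vandermonde fun i => (X (s.succAbove i) ^ m : MvPolynomial (Fin (k + 1 + 1)) ℂ))
    simp only [Matrix.vandermonde_apply] at h
    rw [h, Fin.prod_univ_succ]
    simp only [Fin.val_zero, if_true, Fin.val_succ, Nat.succ_ne_zero, if_false,
      Finset.prod_const_one, mul_one]
    rw [Fin.prod_univ_succAbove _ s]
    ring
  rw [mul_left_cancel₀ hP hrow, monomialGenerator_eq]
  exact (associated_det_vandermonde (fun i => X i ^ m) s).mul_left _

theorem minorsIdeal_monomialMatrix {m n : ℕ} (hm : 0 < m) (hn : 1 ≤ n) :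
    minorsIdeal n (monomialMatrix m n) = Ideal.span (Set.range (monomialGenerator m n)) := by
  rw [minorsIdeal_eq_span]
  exact span_range_eq_of_associated (associated_det_monomialMatrix hm hn)

theorem pderiv_prod_X {σ : Type*} [Fintype σ] [DecidableEq σ] (i : σ) :
    pderiv i (∏ k, X k : MvPolynomial σ ℂ) = ∏ k ∈ Finset.univ.erase i, X k := by
  rw [← Finset.mul_prod_erase _ _ (Finset.mem_univ i), Derivation.leibniz, pderiv_X_self]
  have h : ∀ T : Finset σ, i ∉ T → pderiv i (∏ k ∈ T, X k : MvPolynomial σ ℂ) = 0 := by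
    intro T
    induction T using Finset.induction_on with
    | empty => simp
    | insert a T ha ih =>
      intro hi
      rw [Finset.mem_insert, not_or] at hi
      rw [Finset.prod_insert ha, Derivation.leibniz, ih hi.2, pderiv_X_of_ne (Ne.symm hi.1)]
      simp
  rw [h _ (Finset.notMem_erase i _)]
  simp

theorem jacobianMatrix_monomialInvariants (m n : ℕ) (i : Fin (n + 1)) (j : Fin n) :
    jacobianMatrix (fun j : Fin n => monomialInvariants m n j.castSucc) i j =
      C (if (j : ℕ) = 0 then 1 else (m * j : ℂ)) * monomialMatrix m n i j := by
  rw [jacobianMatrix, Matrix.of_apply, monomialInvariants, monomialMatrix, Matrix.of_apply,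
    Fin.val_castSucc]
  split_ifs with hj
  · rw [pderiv_prod_X, C_1, one_mul]
  · rw [map_sum, Finset.sum_eq_single i]
    · rw [pderiv_pow, pderiv_X_self, mul_one, mul_comm m]
      simp [mul_comm]
    · intro b _ hb
      rw [pderiv_pow, pderiv_X_of_ne hb, mul_zero]
    · simp

theorem minorsIdeal_jacobianMatrix {m n : ℕ} (hm : 0 < m) :
    minorsIdeal n (jacobianMatrix fun j : Fin n => monomialInvariants m n j.castSucc) =
      minorsIdeal n (monomialMatrix m n) := by
  rw [minorsIdeal_eq_span, minorsIdeal_eq_span]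
  refine span_range_eq_of_associated fun s => ?_
  have h := Matrix.det_mul_row
    (fun j : Fin n => (C (if (j : ℕ) = 0 then 1 else (m * j : ℂ)) :
      MvPolynomial (Fin (n + 1)) ℂ)) ((monomialMatrix m n).submatrix s.succAbove id)
  have e : (jacobianMatrix fun j : Fin n => monomialInvariants m n j.castSucc).submatrix
      s.succAbove id = Matrix.of fun (i j : Fin n) => C (if (j : ℕ) = 0 then 1 else (m * j : ℂ)) *
        (monomialMatrix m n).submatrix s.succAbove id i j := by
    ext1 i j
    exact jacobianMatrix_monomialInvariants m n _ j
  rw [e, h, ← map_prod]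
  refine associated_unit_mul_left _ _ (IsUnit.map C (IsUnit.mk0 _ ?_))
  refine Finset.prod_ne_zero_iff.mpr fun j _ => ?_
  split_ifs with hj
  · exact one_ne_zero
  · exact mul_ne_zero (Nat.cast_ne_zero.mpr hm.ne') (Nat.cast_ne_zero.mpr hj)

/-! ### The arrangement and its jacobian ideal -/

section

variable {N : ℕ}

/-- The hyperplane `x_i = ζ x_j`. -/
def mirror (i j : Fin N) (ζ : ℂ) : Submodule ℂ (Fin N → ℂ) :=
  LinearMap.ker (LinearMap.proj i - ζ • LinearMap.proj j : (Fin N → ℂ) →ₗ[ℂ] ℂ)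

theorem mem_mirror {i j : Fin N} {ζ : ℂ} {v : Fin N → ℂ} : v ∈ mirror i j ζ ↔ v i = ζ * v j := by
  simp [mirror, sub_eq_zero]

theorem mem_fixedSpace {g : GL (Fin N) ℂ} {a : Fin N → ℂ} {σ : Equiv.Perm (Fin N)}
    (hg : ∀ i j, (g : Matrix (Fin N) (Fin N) ℂ) i j = if σ i = j then a i else 0)
    {v : Fin N → ℂ} : v ∈ fixedSpace g ↔ ∀ i, a i * v (σ i) = v i := by
  rw [fixedSpace, LinearMap.mem_eqLocus, Matrix.toLin'_apply, LinearMap.id_apply, funext_iff]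
  refine forall_congr' fun i => ?_
  simp [Matrix.mulVec, dotProduct, hg]

theorem eq_ker_of_le {H : Submodule ℂ (Fin N → ℂ)} (hH : Module.finrank ℂ H + 1 = N)
    {φ : Module.Dual ℂ (Fin N → ℂ)} (hφ : φ ≠ 0) (hle : H ≤ LinearMap.ker φ) :
    H = LinearMap.ker φ := by
  refine Submodule.eq_of_le_of_finrank_eq hle ?_
  have := Module.Dual.finrank_ker_add_one_of_ne_zero hφ
  rw [Module.finrank_fin_fun] at this
  omega

theorem proj_sub_smul_proj_ne_zero {i j : Fin N} (hij : i ≠ j) (ζ : ℂ) :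
    (LinearMap.proj i - ζ • LinearMap.proj j : Module.Dual ℂ (Fin N → ℂ)) ≠ 0 := fun h => by
  have := LinearMap.congr_fun h (Pi.single i 1)
  simp [hij.symm] at this

theorem finrank_mirror {i j : Fin N} (hij : i ≠ j) (ζ : ℂ) :
    Module.finrank ℂ (mirror i j ζ) + 1 = N := by
  have := Module.Dual.finrank_ker_add_one_of_ne_zero (proj_sub_smul_proj_ne_zero hij ζ)
  rwa [Module.finrank_fin_fun] at this

theorem mirror_symm {i j : Fin N} {ζ : ℂ} (hζ : ζ ≠ 0) : mirror i j ζ = mirror j i ζ⁻¹ := by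
  ext v
  rw [mem_mirror, mem_mirror, eq_inv_mul_iff_mul_eq₀ hζ, eq_comm]

/-- The reflection in `x_i = ζ x_j` swaps the two coordinates with weights `ζ` and `ζ⁻¹`. -/
theorem exists_reflection {m : ℕ} (hm : 0 < m) {i j : Fin N} (hij : i ≠ j) {ζ : ℂ}
    (hζ : ζ ^ m = 1) :
    ∃ g ∈ monomialGroup m N, IsPseudoreflection g ∧ mirror i j ζ = fixedSpace g := by
  have hζ0 : ζ ≠ 0 := by
    rintro rfl
    rw [zero_pow hm.ne'] at hζ
    exact zero_ne_one hζ
  let a : Fin N → ℂ := fun k => if k = i then ζ else if k = j then ζ⁻¹ else 1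
  have hai : a i = ζ := if_pos rfl
  have haj : a j = ζ⁻¹ := by simp [a, hij.symm]
  have hak : ∀ k, k ≠ i → k ≠ j → a k = 1 := fun k h1 h2 => by simp [a, h1, h2]
  have haa : ∀ k, a k * a (Equiv.swap i j k) = 1 := by
    intro k
    by_cases hki : k = i
    · rw [hki, Equiv.swap_apply_left, hai, haj, mul_inv_cancel₀ hζ0]
    · by_cases hkj : k = j
      · rw [hkj, Equiv.swap_apply_right, hai, haj, inv_mul_cancel₀ hζ0]
      · rw [Equiv.swap_apply_of_ne_of_ne hki hkj, hak k hki hkj, one_mul]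
  let A : Matrix (Fin N) (Fin N) ℂ := Matrix.of fun k l => if Equiv.swap i j k = l then a k else 0
  have hAA : A * A = 1 := by
    ext k l
    rw [Matrix.mul_apply, Finset.sum_eq_single (Equiv.swap i j k)]
    · simp only [A, Matrix.of_apply, if_true, Equiv.swap_apply_self, mul_ite, mul_zero, haa,
        Matrix.one_apply]
    · intro p _ hp
      simp only [A, Matrix.of_apply, if_neg (Ne.symm hp), zero_mul]
    · simp
  have hfix : mirror i j ζ = fixedSpace (⟨A, A, hAA, hAA⟩ : GL (Fin N) ℂ) := by
    ext v
    rw [mem_mirror, mem_fixedSpace (a := a) (σ := Equiv.swap i j) fun _ _ => rfl]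
    constructor
    · intro hv k
      by_cases hki : k = i
      · rw [hki, Equiv.swap_apply_left, hai, hv]
      · by_cases hkj : k = j
        · rw [hkj, Equiv.swap_apply_right, haj, hv, inv_mul_cancel_left₀ hζ0]
        · rw [Equiv.swap_apply_of_ne_of_ne hki hkj, hak k hki hkj, one_mul]
    · intro hv
      have := hv i
      rw [Equiv.swap_apply_left, hai] at this
      exact this.symm
  refine ⟨⟨A, A, hAA, hAA⟩, ⟨a, Equiv.swap i j, ?_, ?_, fun _ _ => rfl⟩, ⟨?_, ?_⟩, hfix⟩
  · intro k
    by_cases hki : k = i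
    · rw [hki, hai, hζ]
    · by_cases hkj : k = j
      · rw [hkj, haj, inv_pow, hζ, inv_one]
      · rw [hak k hki hkj, one_pow]
  · rw [Fintype.prod_eq_mul i j hij fun k hk => hak k hk.1 hk.2, hai, haj, mul_inv_cancel₀ hζ0]
  · exact isOfFinOrder_iff_pow_eq_one.mpr ⟨2, two_pos, Units.ext ((pow_two A).trans hAA)⟩
  · rw [← hfix, finrank_mirror hij]

/-- The mirrors of `G(m, m, N)` are the hyperplanes `x_i = ζ x_j` with `ζ ^ m = 1`. A diagonal
pseudoreflection would have exactly one diagonal entry different from `1`, which contradicts the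
condition on the product of the entries. -/
theorem mem_reflectionArrangement {m : ℕ} (hm : 0 < m) {H : Submodule ℂ (Fin N → ℂ)} :
    H ∈ reflectionArrangement (monomialGroup m N) ↔
      ∃ i j ζ, i < j ∧ ζ ^ m = 1 ∧ H = mirror i j ζ := by
  constructor
  · rintro ⟨g, ⟨a, σ, ham, ha1, hg⟩, ⟨-, hdim⟩, rfl⟩
    have ha0 : ∀ i, a i ≠ 0 := fun i h => by
      have := ham i
      rw [h, zero_pow hm.ne'] at this
      exact zero_ne_one this
    by_cases hσ : ∃ i, σ i ≠ i
    -- One moved coordinate confines the fixed hyperplane to a mirror, hence equals it.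
    · obtain ⟨i, hi⟩ := hσ
      have h : fixedSpace g = mirror i (σ i) (a i) :=
        eq_ker_of_le hdim (proj_sub_smul_proj_ne_zero hi.symm (a i)) fun v hv =>
          mem_mirror.mpr ((mem_fixedSpace hg).mp hv i).symm
      rcases lt_or_gt_of_ne hi with hlt | hlt
      · exact ⟨σ i, i, (a i)⁻¹, hlt, by rw [inv_pow, ham, inv_one], by rw [h, mirror_symm (ha0 i)]⟩
      · exact ⟨i, σ i, a i, hlt, ham i, h⟩
    · exfalso
      push Not at hσ
      have hker : ∀ i, a i ≠ 1 → fixedSpace g =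
          LinearMap.ker (LinearMap.proj i : (Fin N → ℂ) →ₗ[ℂ] ℂ) := by
        intro i hi
        refine eq_ker_of_le hdim (fun h => ?_) fun v hv => ?_
        · have := LinearMap.congr_fun h (Pi.single i 1)
          simp at this
        · have := (mem_fixedSpace hg).mp hv i
          rw [hσ] at this
          rw [LinearMap.mem_ker, LinearMap.proj_apply]
          by_contra hne
          exact hi (mul_right_cancel₀ hne (this.trans (one_mul _).symm))
      have hex : ∃ i, a i ≠ 1 := by
        by_contra hall
        push Not at hall
        have htop : fixedSpace g = ⊤ := by
          rw [eq_top_iff]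
          intro v _
          rw [mem_fixedSpace hg]
          intro i
          rw [hall, hσ, one_mul]
        rw [htop, finrank_top, Module.finrank_fin_fun] at hdim
        omega
      obtain ⟨i, hi⟩ := hex
      have hex' : ∃ j, j ≠ i ∧ a j ≠ 1 := by
        by_contra hall
        push Not at hall
        rw [Fintype.prod_eq_single i hall] at ha1
        exact hi ha1
      obtain ⟨j, hji, hj⟩ := hex'
      have hmem : (Pi.single j 1 : Fin N → ℂ) ∈
          LinearMap.ker (LinearMap.proj i : (Fin N → ℂ) →ₗ[ℂ] ℂ) := by
        simp [hji]
      rw [← hker i hi, hker j hj] at hmem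
      simp at hmem
  · rintro ⟨i, j, ζ, hij, hζ, rfl⟩
    exact exists_reflection hm hij.ne hζ

theorem mirror_injective {i j k l : Fin N} {ζ ξ : ℂ} (hij : i < j) (hkl : k < l) (hζ : ζ ≠ 0)
    (h : mirror i j ζ = mirror k l ξ) : i = k ∧ j = l ∧ ζ = ξ := by
  have hv : ∀ v : Fin N → ℂ, v i = ζ * v j ↔ v k = ξ * v l := fun v => by
    rw [← mem_mirror, ← mem_mirror, h]
  have hi : i = k ∨ i = l := by
    by_contra hne
    push Not at hne
    have := (hv (Pi.single i 1)).mpr (by simp [hne.1.symm, hne.2.symm])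
    simp [hij.ne'] at this
  have hj : j = k ∨ j = l := by
    by_contra hne
    push Not at hne
    have := (hv (Pi.single j 1)).mpr (by simp [hne.1.symm, hne.2.symm])
    simp [hij.ne] at this
    exact hζ this.symm
  have hik : i = k := by
    rcases hi with hi | hi
    · exact hi
    · rcases hj with hj | hj
      · rw [hi, hj] at hij
        exact absurd hij hkl.not_gt
      · rw [hi, hj] at hij
        exact absurd hij (lt_irrefl _)
  have hjl : j = l := hj.resolve_left fun e => hij.ne (hik.trans e.symm)
  subst hik hjl
  refine ⟨rfl, rfl, ?_⟩
  have := (hv (Function.update (Pi.single j 1) i ζ)).mp (by simp [hij.ne'])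
  simpa [hij.ne'] using this

theorem associated_linearForm {i j : Fin N} (hij : i < j) {ζ : ℂ} {c : Fin N → ℂ}
    (hc : ∀ v : Fin N → ℂ, v ∈ mirror i j ζ ↔ c ⬝ᵥ v = 0) :
    Associated (linearForm c) (X i - C ζ * X j) := by
  simp only [mem_mirror] at hc
  have hk : ∀ k, k ≠ i ∧ k ≠ j → c k = 0 := fun k hk => by
    have := (hc (Pi.single k 1)).mp (by simp [hk.1.symm, hk.2.symm])
    simpa using this
  have hi : c i ≠ 0 := fun h => by
    have := (hc (Pi.single i 1)).mpr (by simp [h])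
    simp [hij.ne'] at this
  have hj : c j = -(c i * ζ) := by
    have := (hc (Pi.single i ζ + Pi.single j 1)).mp (by simp [hij.ne, hij.ne'])
    rw [dotProduct_add, dotProduct_single, dotProduct_single, mul_one] at this
    exact eq_neg_of_add_eq_zero_right this
  have h : linearForm c = C (c i) * (X i - C ζ * X j) := by
    rw [linearForm, Fintype.sum_eq_add i j hij.ne fun k h => by rw [hk k h, C_0, zero_mul], hj,
      C_neg, C_mul]
    ring
  rw [h]
  exact associated_unit_mul_left _ _ (IsUnit.map C (IsUnit.mk0 _ hi))

theorem prod_X_sub_root_mul_X {m : ℕ} (hm : 0 < m) (i j : Fin N) :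
    ∏ ζ ∈ Polynomial.nthRootsFinset m (1 : ℂ), (X i - C ζ * X j : MvPolynomial (Fin N) ℂ) =
      X i ^ m - X j ^ m := by
  refine MvPolynomial.funext fun v => ?_
  rw [map_prod]
  simp only [map_sub, map_mul, map_pow, eval_X, eval_C]
  exact ((Complex.isPrimitiveRoot_exp m hm.ne').pow_sub_pow_eq_prod_sub_mul (v i) (v j) hm).symm

open Classical in
theorem associated_of_isDefiningPolynomial {m : ℕ} (hm : 0 < m) {F : MvPolynomial (Fin N) ℂ}
    (hF : IsDefiningPolynomial (reflectionArrangement (monomialGroup m N)) F) :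
    Associated F (pairProd (fun i => X i ^ m) Finset.univ) := by
  obtain ⟨hA, c, hc, rfl⟩ := hF
  let Φ : Finset ((Fin N × Fin N) × ℂ) :=
    (Finset.univ.filter fun p : Fin N × Fin N => p.1 < p.2) ×ˢ Polynomial.nthRootsFinset m (1 : ℂ)
  have hΦ : ∀ q, q ∈ Φ ↔ q.1.1 < q.1.2 ∧ q.2 ^ m = 1 := fun q => by
    simp [Φ, Polynomial.mem_nthRootsFinset hm]
  have himg : hA.toFinset = Φ.image fun q => mirror q.1.1 q.1.2 q.2 := by
    ext H
    rw [Set.Finite.mem_toFinset, mem_reflectionArrangement hm, Finset.mem_image]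
    constructor
    · rintro ⟨i, j, ζ, hij, hζ, rfl⟩
      exact ⟨((i, j), ζ), (hΦ _).mpr ⟨hij, hζ⟩, rfl⟩
    · rintro ⟨q, hq, rfl⟩
      exact ⟨_, _, _, ((hΦ q).mp hq).1, ((hΦ q).mp hq).2, rfl⟩
  have hinj : Set.InjOn (fun q : (Fin N × Fin N) × ℂ => mirror q.1.1 q.1.2 q.2) Φ := by
    intro q hq r hr h
    obtain ⟨hq1, hq2⟩ := (hΦ q).mp hq
    obtain ⟨hr1, -⟩ := (hΦ r).mp hr
    have hq0 : q.2 ≠ 0 := fun h0 => by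
      rw [h0, zero_pow hm.ne'] at hq2
      exact zero_ne_one hq2
    obtain ⟨h1, h2, h3⟩ := mirror_injective hq1 hr1 hq0 h
    exact Prod.ext (Prod.ext h1 h2) h3
  have hprod : pairProd (fun i => X i ^ m : Fin N → MvPolynomial (Fin N) ℂ) Finset.univ =
      ∏ q ∈ Φ, (X q.1.1 - C q.2 * X q.1.2) := by
    rw [Finset.prod_product, pairProd, ← Finset.prod_product', ← Finset.prod_filter,
      Finset.univ_product_univ]
    exact Finset.prod_congr rfl fun p _ => (prod_X_sub_root_mul_X hm p.1 p.2).symm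
  rw [hprod, himg, Finset.prod_image hinj]
  refine Associated.prod _ _ _ fun q hq => associated_linearForm ((hΦ q).mp hq).1 (hc _ ?_)
  exact (mem_reflectionArrangement hm).mpr
    ⟨_, _, _, ((hΦ q).mp hq).1, ((hΦ q).mp hq).2, rfl⟩

theorem exists_isDefiningPolynomial {m : ℕ} (hm : 0 < m) :
    ∃ F, IsDefiningPolynomial (reflectionArrangement (monomialGroup m N)) F := by
  have hfin : (reflectionArrangement (monomialGroup m N)).Finite := by
    refine Set.Finite.subset (((Set.finite_univ (α := Fin N × Fin N)).prod
      (Polynomial.nthRootsFinset m (1 : ℂ)).finite_toSet).image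
        fun q => mirror q.1.1 q.1.2 q.2) fun H hH => ?_
    obtain ⟨i, j, ζ, -, hζ, rfl⟩ := (mem_reflectionArrangement hm).mp hH
    exact ⟨((i, j), ζ), ⟨Set.mem_univ _, (Polynomial.mem_nthRootsFinset hm 1).mpr hζ⟩, rfl⟩
  have hc : ∀ H : Submodule ℂ (Fin N → ℂ), ∃ c : Fin N → ℂ,
      H ∈ reflectionArrangement (monomialGroup m N) → ∀ v : Fin N → ℂ, v ∈ H ↔ c ⬝ᵥ v = 0 := by
    intro H
    by_cases hH : H ∈ reflectionArrangement (monomialGroup m N)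
    · obtain ⟨i, j, ζ, -, -, rfl⟩ := (mem_reflectionArrangement hm).mp hH
      refine ⟨Pi.single i 1 - Pi.single j ζ, fun _ v => ?_⟩
      rw [mem_mirror, sub_dotProduct, single_dotProduct, single_dotProduct, one_mul, sub_eq_zero]
    · exact ⟨0, fun h => absurd h hH⟩
  choose c hc using hc
  exact ⟨_, hfin, c, hc, rfl⟩

theorem pderiv_dvd_of_associated {σ : Type*} {F G : MvPolynomial σ ℂ} (h : Associated F G)
    (i : σ) : pderiv i F ∣ pderiv i G := by
  obtain ⟨u, rfl⟩ := h
  obtain ⟨r, -, hr⟩ := MvPolynomial.isUnit_iff_eq_C_of_isReduced.mp u.isUnit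
  rw [hr, mul_comm, pderiv_C_mul]
  exact ⟨C r, mul_comm _ _⟩

/-- Defining polynomials exist and agree up to nonzero constants with `∏ (x_i ^ m - x_j ^ m)`, so
the partial derivatives of this product generate the jacobian ideal. -/
theorem jacobianIdeal_eq {m : ℕ} (hm : 0 < m) :
    jacobianIdeal (reflectionArrangement (monomialGroup m N)) =
      Ideal.span (Set.range fun i : Fin N =>
        pderiv i (pairProd (fun i => X i ^ m : Fin N → MvPolynomial (Fin N) ℂ) Finset.univ)) := by
  refine le_antisymm (Ideal.span_le.mpr ?_) (Ideal.span_le.mpr ?_)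
  · rintro _ ⟨F, i, hF, rfl⟩
    exact Ideal.mem_of_dvd _
      (pderiv_dvd_of_associated (associated_of_isDefiningPolynomial hm hF).symm i)
      (Ideal.subset_span ⟨i, rfl⟩)
  · rintro _ ⟨i, rfl⟩
    obtain ⟨F, hF⟩ := exists_isDefiningPolynomial (N := N) hm
    exact Ideal.mem_of_dvd _ (pderiv_dvd_of_associated (associated_of_isDefiningPolynomial hm hF) i)
      (Ideal.subset_span ⟨F, i, hF, rfl⟩)

end

/-! ### The singular locus -/

theorem dvd_pderiv_prod {σ ι : Type*} {i : σ} {q : MvPolynomial σ ℂ} {T : Finset ι}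
    {f : ι → MvPolynomial σ ℂ} (h : ∀ j ∈ T, q ∣ pderiv i (f j)) :
    q ∣ pderiv i (∏ j ∈ T, f j) := by
  classical
  induction T using Finset.induction_on with
  | empty => simp
  | insert a T ha ih =>
    rw [Finset.prod_insert ha, Derivation.leibniz, smul_eq_mul, smul_eq_mul]
    exact dvd_add ((ih fun j hj => h j (Finset.mem_insert_of_mem hj)).mul_left _)
      ((h a (Finset.mem_insert_self a T)).mul_left _)

theorem X_dvd_pderiv_X_pow {σ : Type*} {m : ℕ} (hm : 2 ≤ m) (i j : σ) :
    X i ∣ pderiv i (X j ^ m : MvPolynomial σ ℂ) := by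
  rw [pderiv_pow]
  by_cases h : j = i
  · subst h
    exact ((dvd_pow_self _ (by omega)).mul_left _).mul_right _
  · rw [pderiv_X_of_ne h, mul_zero]
    exact dvd_zero _

theorem pderiv_pairProd_X_pow {σ : Type*} [LinearOrder σ] {m : ℕ} {i : σ} {T : Finset σ}
    (hi : i ∉ T) :
    pderiv i (pairProd (fun j => X j ^ m : σ → MvPolynomial σ ℂ) T) = 0 := by
  have h : ∀ j ∈ T, pderiv i (X j ^ m : MvPolynomial σ ℂ) = 0 := fun j hj => by
    have hji : j ≠ i := fun e => hi (e ▸ hj)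
    rw [pderiv_pow, pderiv_X_of_ne hji, mul_zero]
  -- Divisibility by zero is vanishing.
  refine zero_dvd_iff.mp (dvd_pderiv_prod fun a ha => dvd_pderiv_prod fun b hb => ?_)
  rw [zero_dvd_iff]
  split_ifs
  · rw [map_sub, h a ha, h b hb, sub_zero]
  · exact pderiv_one

/-- The `i`-th partial derivative is divisible by the `i`-th generator: the factors of the defining
polynomial involving `x_i` are polynomials in `x_i ^ m`, whose derivatives are multiples of `x_i`
because `m ≥ 2`. -/
theorem jacobianIdeal_le {m n : ℕ} (hm : 2 ≤ m) :
    jacobianIdeal (reflectionArrangement (monomialGroup m (n + 1))) ≤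
      Ideal.span (Set.range (monomialGenerator m n)) := by
  rw [jacobianIdeal_eq (by omega), Ideal.span_le]
  rintro _ ⟨i, rfl⟩
  have h := pairProd_erase (fun j => X j ^ m : Fin (n + 1) → MvPolynomial (Fin (n + 1)) ℂ)
    (Finset.mem_univ i)
  refine Ideal.mem_of_dvd _ (Dvd.dvd.trans ?_ (pderiv_dvd_of_associated h.symm i))
    (Ideal.subset_span ⟨i, rfl⟩)
  rw [Derivation.leibniz, pderiv_pairProd_X_pow (Finset.notMem_erase i _), smul_zero, zero_add,
    smul_eq_mul, mul_comm, monomialGenerator_eq]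
  refine mul_dvd_mul_right (dvd_pderiv_prod fun j _ => ?_) _
  rw [map_sub]
  exact dvd_sub (X_dvd_pderiv_X_pow hm i i) (X_dvd_pderiv_X_pow hm i j)

theorem eval_pairProd_X_pow {σ : Type*} [LinearOrder σ] (m : ℕ) (p : σ → ℂ) (T : Finset σ) :
    eval p (pairProd (fun j => X j ^ m) T) = pairProd (fun j => p j ^ m) T := by
  rw [map_pairProd]
  simp only [map_pow, eval_X]

theorem isHomogeneous_pairProd_X_pow {σ : Type*} [LinearOrder σ] (m : ℕ) (T : Finset σ) :
    (pairProd (fun j => X j ^ m : σ → MvPolynomial σ ℂ) T).IsHomogeneous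
      (∑ i ∈ T, ∑ j ∈ T, if i < j then m else 0) := by
  refine IsHomogeneous.prod _ _ _ fun i _ => IsHomogeneous.prod _ _ _ fun j _ => ?_
  split_ifs
  · simpa using ((isHomogeneous_X_pow (R := ℂ) i m).sub (isHomogeneous_X_pow j m))
  · exact isHomogeneous_one _ _

/-- At a singular point of the arrangement on the mirror `x_i ^ m = x_j ^ m`, the product rule
shows that `x_i = 0` or that a second difference vanishes. -/
theorem mul_pairProd_eq_zero {m N : ℕ} (hm : 2 ≤ m) {p : Fin N → ℂ} {i j : Fin N}
    (hij : i ≠ j) (hy : p i ^ m = p j ^ m)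
    (hp : eval p (pderiv i (pairProd (fun j => X j ^ m) Finset.univ)) = 0) :
    p i * pairProd (fun k => p k ^ m) (Finset.univ.erase i) = 0 := by
  have hj : j ∈ Finset.univ.erase i := Finset.mem_erase.mpr ⟨hij.symm, Finset.mem_univ j⟩
  have h := pairProd_erase (fun j => X j ^ m : Fin N → MvPolynomial (Fin N) ℂ)
    (Finset.mem_univ i)
  rw [← Finset.mul_prod_erase _ _ hj, mul_assoc] at h
  obtain ⟨r, hr⟩ := pderiv_dvd_of_associated h i
  rw [Derivation.leibniz, map_sub, pderiv_pow, pderiv_pow, pderiv_X_self,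
    pderiv_X_of_ne hij.symm] at hr
  have h0 := congrArg (eval p) hr
  simp only [smul_eq_mul, map_mul, map_add, map_sub, map_pow, eval_X, map_prod, map_natCast,
    eval_pairProd_X_pow, mul_zero, sub_zero, mul_one, hp, zero_mul, hy, sub_self,
    zero_add] at h0
  rcases mul_eq_zero.mp h0 with h1 | h1
  · rcases mul_eq_zero.mp h1 with h2 | h2
    · obtain ⟨k, hk, hk0⟩ := Finset.prod_eq_zero_iff.mp h2
      rw [sub_eq_zero] at hk0
      rw [pairProd_eq_zero hj (Finset.mem_of_mem_erase hk) (Finset.ne_of_mem_erase hk).symm hk0,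
        mul_zero]
    · rw [h2, mul_zero]
  · rcases mul_eq_zero.mp h1 with h2 | h2
    · exact absurd h2 (Nat.cast_ne_zero.mpr (by omega))
    · rw [pow_eq_zero_iff (by omega)] at h2
      rw [h2, zero_mul]

/-- Every generator vanishes at all common zeros of the partial derivatives. -/
theorem span_le_radical_jacobianIdeal {m n : ℕ} (hm : 2 ≤ m) (hn : 1 ≤ n) :
    Ideal.span (Set.range (monomialGenerator m n)) ≤
      (jacobianIdeal (reflectionArrangement (monomialGroup m (n + 1)))).radical := by
  rw [jacobianIdeal_eq (by omega), ← vanishingIdeal_zeroLocus_eq_radical (K := ℂ), Ideal.span_le]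
  rintro _ ⟨s, rfl⟩
  rw [SetLike.mem_coe, mem_vanishingIdeal_iff]
  intro p hp
  rw [zeroLocus_span] at hp
  replace hp : ∀ i, eval p (pderiv i (pairProd (fun i => X i ^ m) Finset.univ)) = 0 :=
    fun i => by simpa [coe_aeval_eq_eval] using hp _ ⟨i, rfl⟩
  -- By Euler's identity the common zero lies on the arrangement, as `Δ` has positive degree.
  have hzero : pairProd (fun i => p i ^ m) Finset.univ = 0 := by
    have hE := congrArg (eval p)
      (isHomogeneous_pairProd_X_pow m (Finset.univ : Finset (Fin (n + 1)))).sum_X_mul_pderiv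
    rw [map_sum, Finset.sum_eq_zero fun i _ => by rw [map_mul, hp i, mul_zero], nsmul_eq_mul,
      map_mul, map_natCast, eval_pairProd_X_pow] at hE
    refine (mul_eq_zero.mp hE.symm).resolve_left (Nat.cast_ne_zero.mpr fun h0 => ?_)
    have h1 := Finset.sum_eq_zero_iff.mp (Finset.sum_eq_zero_iff.mp h0 0 (Finset.mem_univ _))
      (Fin.last n) (Finset.mem_univ _)
    rw [if_pos (Fin.lt_def.mpr (by rw [Fin.val_zero, Fin.val_last]; omega))] at h1
    omega
  obtain ⟨i, j, hij, hy⟩ : ∃ i j, i ≠ j ∧ p i ^ m = p j ^ m := by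
    simp only [pairProd, Finset.prod_eq_zero_iff] at hzero
    obtain ⟨i, -, j, -, h⟩ := hzero
    split_ifs at h with hij
    · exact ⟨i, j, hij.ne, sub_eq_zero.mp h⟩
    · exact absurd h one_ne_zero
  change eval p (monomialGenerator m n s) = 0
  rw [monomialGenerator_eq, map_mul, eval_X,
    eval_pairProd_X_pow]
  by_cases hsi : s = i
  · rw [hsi]
    exact mul_pairProd_eq_zero hm hij hy (hp i)
  · by_cases hsj : s = j
    · rw [hsj]
      exact mul_pairProd_eq_zero hm hij.symm hy.symm (hp j)
    · rw [pairProd_eq_zero (i := i) (j := j) (by grind) (by grind) hij hy, mul_zero]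

theorem singularLocusIdeal_eq {m n : ℕ} (hm : 2 ≤ m) (hn : 1 ≤ n) :
    singularLocusIdeal (reflectionArrangement (monomialGroup m (n + 1))) =
      Ideal.span (Set.range (monomialGenerator m n)) := by
  refine le_antisymm ?_ (span_le_radical_jacobianIdeal hm hn)
  exact (Ideal.radical_mono (jacobianIdeal_le hm)).trans
    (radical_span_monomialGenerator (by omega) hn).le

/-! ### Basic invariants -/

theorem exists_mem_monomialGroup {m N : ℕ} {a : Fin N → ℂ} (ha : ∀ i, a i ^ m = 1)
    (ha1 : ∏ i, a i = 1) (σ : Equiv.Perm (Fin N)) :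
    ∃ g ∈ monomialGroup m N,
      ∀ i j, (g : Matrix (Fin N) (Fin N) ℂ) i j = if σ i = j then a i else 0 := by
  have ha0 : ∀ i, a i ≠ 0 := fun i => Finset.prod_ne_zero_iff.mp (ha1 ▸ one_ne_zero) i
    (Finset.mem_univ i)
  let A : Matrix (Fin N) (Fin N) ℂ := Matrix.of fun i j => if σ i = j then a i else 0
  let B : Matrix (Fin N) (Fin N) ℂ :=
    Matrix.of fun i j => if σ.symm i = j then (a (σ.symm i))⁻¹ else 0
  have hAB : A * B = 1 := by
    ext i j
    rw [Matrix.mul_apply, Finset.sum_eq_single (σ i)]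
    · simp only [A, B, Matrix.of_apply, if_true, Equiv.symm_apply_apply, mul_ite, mul_zero,
        mul_inv_cancel₀ (ha0 _), Matrix.one_apply]
    · intro k _ hk
      simp only [A, Matrix.of_apply, if_neg (Ne.symm hk), zero_mul]
    · simp
  exact ⟨⟨A, B, hAB, mul_eq_one_comm.mp hAB⟩, ⟨a, σ, ha, ha1, fun _ _ => rfl⟩,
    fun _ _ => rfl⟩

theorem mem_invariantRing {N : ℕ} {G : Subgroup (GL (Fin N) ℂ)} {f : MvPolynomial (Fin N) ℂ} :
    f ∈ invariantRing G ↔ ∀ g ∈ G, substitution g f = f := by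
  simp [invariantRing, Algebra.mem_iInf, AlgHom.mem_equalizer]

theorem substitution_eq {N : ℕ} {g : GL (Fin N) ℂ} {a : Fin N → ℂ} {σ : Equiv.Perm (Fin N)}
    (hg : ∀ i j, (g : Matrix (Fin N) (Fin N) ℂ) i j = if σ i = j then a i else 0) :
    substitution g = aeval fun i => C (a i) * X (σ i) := by
  refine algHom_ext fun i => ?_
  rw [substitution, aeval_X, aeval_X, linearForm, Finset.sum_eq_single (σ i)]
  · rw [hg, if_pos rfl]
  · intro k _ hk
    rw [hg, if_neg (Ne.symm hk), C_0, zero_mul]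
  · simp

theorem aeval_eq_of_mem_invariantRing {m N : ℕ} {f : MvPolynomial (Fin N) ℂ}
    (hf : f ∈ invariantRing (monomialGroup m N)) {a : Fin N → ℂ} (ha : ∀ i, a i ^ m = 1)
    (ha1 : ∏ i, a i = 1) (σ : Equiv.Perm (Fin N)) :
    aeval (fun i => (C (a i) * X (σ i) : MvPolynomial (Fin N) ℂ)) f = f := by
  obtain ⟨g, hg, h⟩ := exists_mem_monomialGroup ha ha1 σ
  rw [← substitution_eq h]
  exact mem_invariantRing.mp hf g hg

theorem monomialInvariants_mem_invariantRing (m n : ℕ) (d : Fin (n + 1)) :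
    monomialInvariants m n d ∈ invariantRing (monomialGroup m (n + 1)) := by
  rw [mem_invariantRing]
  rintro g ⟨a, σ, ha, ha1, hg⟩
  rw [substitution_eq hg, monomialInvariants]
  split_ifs
  · simp only [map_prod, aeval_X, Finset.prod_mul_distrib]
    rw [← map_prod, ha1, C_1, one_mul, Equiv.prod_comp σ fun i => (X i : MvPolynomial _ ℂ)]
  · simp only [map_sum, map_pow, aeval_X, mul_pow]
    refine Eq.trans (Finset.sum_congr rfl fun i _ => ?_)
      (Equiv.sum_comp σ fun i => (X i : MvPolynomial _ ℂ) ^ (m * (d : ℕ)))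
    rw [pow_mul (C (a i)), ← C_pow, ha, C_1, one_pow, one_mul]

theorem isHomogeneous_monomialInvariants (m n : ℕ) (d : Fin (n + 1)) :
    ∃ k : ℕ, (monomialInvariants m n d).IsHomogeneous k := by
  rw [monomialInvariants]
  split_ifs
  · exact ⟨_, IsHomogeneous.prod _ _ _ fun i _ => isHomogeneous_X ℂ i⟩
  · exact ⟨_, IsHomogeneous.sum _ _ _ fun i _ => isHomogeneous_X_pow i _⟩

theorem esymm_card (σ : Type*) [Fintype σ] : esymm σ ℂ (Fintype.card σ) = ∏ i, X i := by
  rw [esymm, ← Finset.card_univ, Finset.powersetCard_self, Finset.sum_singleton]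

/-- The elementary symmetric polynomials of the `x_i ^ m` are polynomials in the invariants:
the last one is `(x_0 ⋯ x_n) ^ m`, the others are expressed by Newton's identities. -/
theorem expand_esymm_mem_adjoin (m n k : ℕ) (hk : k ≤ n + 1) :
    expand m (esymm (Fin (n + 1)) ℂ k) ∈ Algebra.adjoin ℂ (Set.range (monomialInvariants m n)) := by
  induction k using Nat.strong_induction_on with
  | _ k ih =>
  set B := Algebra.adjoin ℂ (Set.range (monomialInvariants m n))
  have hB : ∀ d, monomialInvariants m n d ∈ B := fun d => Algebra.subset_adjoin ⟨d, rfl⟩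
  rcases Nat.eq_zero_or_pos k with rfl | hk0
  · rw [esymm_zero, map_one]
    exact one_mem B
  rcases hk.eq_or_lt with rfl | hk'
  · have h : expand m (esymm (Fin (n + 1)) ℂ (n + 1)) = monomialInvariants m n 0 ^ m := by
      have := esymm_card (Fin (n + 1))
      rw [Fintype.card_fin] at this
      rw [this, monomialInvariants, if_pos (Fin.val_zero _), map_prod, ← Finset.prod_pow]
      exact Finset.prod_congr rfl fun i _ => expand_X m i
    rw [h]
    exact pow_mem (hB 0) m
  · have hpsum : ∀ d, 0 < d → d ≤ k → expand m (psum (Fin (n + 1)) ℂ d) ∈ B := by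
      intro d hd0 hdk
      have h : expand m (psum (Fin (n + 1)) ℂ d) = monomialInvariants m n ⟨d, by omega⟩ := by
        rw [monomialInvariants, if_neg hd0.ne', psum, map_sum]
        refine Finset.sum_congr rfl fun i _ => ?_
        rw [map_pow, expand_X, ← pow_mul]
      rw [h]
      exact hB _
    have hN := congrArg (expand m) (mul_esymm_eq_sum (Fin (n + 1)) ℂ k)
    have hmem : (k : MvPolynomial (Fin (n + 1)) ℂ) * expand m (esymm (Fin (n + 1)) ℂ k) ∈ B := by
      rw [map_mul, map_natCast] at hN
      rw [hN, map_mul, map_sum]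
      have hneg : ∀ r : ℕ, expand m ((-1 : MvPolynomial (Fin (n + 1)) ℂ) ^ r) ∈ B := fun r => by
        rw [map_pow, map_neg, map_one]
        exact pow_mem (neg_mem (one_mem B)) r
      refine mul_mem (hneg _) (sum_mem fun p hp => ?_)
      rw [Finset.mem_filter, Finset.HasAntidiagonal.mem_antidiagonal] at hp
      rw [map_mul, map_mul]
      exact mul_mem (mul_mem (hneg _) (ih _ hp.2 (by omega))) (hpsum _ (by omega) (by omega))
    have hk1 : (k : ℂ) ≠ 0 := Nat.cast_ne_zero.mpr hk0.ne'
    have h2 := B.smul_mem hmem (k : ℂ)⁻¹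
    rwa [smul_eq_C_mul, ← mul_assoc, ← map_natCast (C : ℂ →+* MvPolynomial (Fin (n + 1)) ℂ),
      ← C_mul, inv_mul_cancel₀ hk1, C_1, one_mul] at h2

theorem expand_mem_adjoin_of_isSymmetric {m n : ℕ} {h : MvPolynomial (Fin (n + 1)) ℂ}
    (hh : h.IsSymmetric) :
    expand m h ∈ Algebra.adjoin ℂ (Set.range (monomialInvariants m n)) := by
  obtain ⟨q, hq⟩ := esymmAlgHom_surjective (σ := Fin (n + 1)) ℂ (n := n + 1)
    (by rw [Fintype.card_fin]) ⟨h, hh⟩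
  have h1 : aeval (fun i : Fin (n + 1) => esymm (Fin (n + 1)) ℂ (i + 1)) q = h := by
    rw [← esymmAlgHom_apply, hq]
  rw [← h1]
  clear hq h1 hh
  induction q using MvPolynomial.induction_on with
  | C r =>
    rw [aeval_C, AlgHom.commutes]
    exact Subalgebra.algebraMap_mem _ r
  | add p q hp hq =>
    rw [map_add, map_add]
    exact add_mem hp hq
  | mul_X p i hp =>
    rw [map_mul, map_mul, aeval_X]
    exact mul_mem hp (expand_esymm_mem_adjoin m n _ (by omega))

/-- In a polynomial invariant under the diagonal matrices of `G(m, m, n + 1)`, only the residue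
terms with constant exponents occur. -/
theorem eq_of_residue_ne_zero {m n : ℕ} (hm : 0 < m)
    {h : (Fin (n + 1) → Fin m) → MvPolynomial (Fin (n + 1)) ℂ}
    (hf : ∑ e, residueTerm e (h e) ∈ invariantRing (monomialGroup m (n + 1)))
    {e : Fin (n + 1) → Fin m} (he : h e ≠ 0) (i j : Fin (n + 1)) : e i = e j := by
  by_contra hne
  have hij : i ≠ j := fun h => hne (h ▸ rfl)
  have hζ := Complex.isPrimitiveRoot_exp m hm.ne'
  set ζ := Complex.exp (2 * Real.pi * Complex.I / m)
  have hζ0 : ζ ≠ 0 := hζ.ne_zero hm.ne'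
  -- The diagonal matrix with entries `ζ` at `i` and `ζ⁻¹` at `j` multiplies the term by
  -- `ζ ^ (e_i - e_j)`.
  let u : Fin (n + 1) → ℂ := fun k => if k = i then ζ else if k = j then ζ⁻¹ else 1
  have hui : u i = ζ := if_pos rfl
  have huj : u j = ζ⁻¹ := by simp [u, hij.symm]
  have huk : ∀ k, k ≠ i ∧ k ≠ j → u k = 1 := fun k hk => by simp [u, hk.1, hk.2]
  have hu : ∀ k, u k ^ m = 1 := by
    intro k
    simp only [u]
    split_ifs <;> simp [hζ.pow_eq_one]
  have hu1 : ∏ k, u k = 1 := by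
    rw [Fintype.prod_eq_mul i j hij huk, hui, huj, mul_inv_cancel₀ hζ0]
  have hinv : scale u (∑ e, residueTerm e (h e)) = ∑ e, residueTerm e (h e) :=
    aeval_eq_of_mem_invariantRing hf hu hu1 1
  have hsub : ∑ e, residueTerm e ((C (∏ i, u i ^ (e i : ℕ)) - 1) * h e) = 0 := by
    rw [← sub_eq_zero] at hinv
    rw [← hinv, map_sum, ← Finset.sum_sub_distrib]
    refine Finset.sum_congr rfl fun e _ => ?_
    rw [scale_residueTerm hu, residueTerm, residueTerm, map_mul, map_sub, expand_C, map_one]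
    ring
  have h0 := (mul_eq_zero.mp (eq_zero_of_sum_residueTerm_eq_zero hm hsub e)).resolve_right he
  rw [← C_1, ← C_sub, C_eq_zero, sub_eq_zero,
    Fintype.prod_eq_mul i j hij fun k hk => by rw [huk k hk, one_pow], hui, huj, inv_pow] at h0
  have h1 : ζ ^ (e i : ℕ) = ζ ^ (e j : ℕ) :=
    (mul_inv_eq_one₀ (pow_ne_zero _ hζ0)).mp h0
  exact hne (Fin.ext (hζ.pow_inj (e i).2 (e j).2 h1))

theorem rename_residueTerm {m N : ℕ} (σ : Equiv.Perm (Fin N)) (e : Fin N → Fin m)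
    (h : MvPolynomial (Fin N) ℂ) :
    rename σ (residueTerm (e ∘ σ) h) = residueTerm e (rename σ h) := by
  rw [residueTerm, residueTerm, map_mul, rename_expand, map_prod]
  congr 1
  refine Eq.trans (Finset.prod_congr rfl fun i _ => ?_)
    (Equiv.prod_comp σ fun i => (X i : MvPolynomial _ ℂ) ^ (e i : ℕ))
  rw [map_pow, rename_X, Function.comp_apply]

/-- The residue components with constant exponents of an invariant polynomial are symmetric. -/
theorem isSymmetric_residue {m n : ℕ} (hm : 0 < m)
    {h : (Fin (n + 1) → Fin m) → MvPolynomial (Fin (n + 1)) ℂ}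
    (hf : ∑ e, residueTerm e (h e) ∈ invariantRing (monomialGroup m (n + 1)))
    {e : Fin (n + 1) → Fin m} (he : ∀ i j, e i = e j) : (h e).IsSymmetric := by
  intro σ
  have hinv := aeval_eq_of_mem_invariantRing hf (a := fun _ => 1) (by simp) (by simp) σ
  simp only [C_1, one_mul] at hinv
  have hrename : (aeval fun i => (X (σ i) : MvPolynomial (Fin (n + 1)) ℂ)) = rename (R := ℂ) σ :=
    algHom_ext fun i => by rw [aeval_X, rename_X]
  rw [hrename] at hinv
  have hcomp : ∑ e, residueTerm e (rename σ (h (e ∘ σ)) - h e) = 0 := by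
    rw [← sub_eq_zero] at hinv
    rw [← hinv, map_sum, ← Equiv.sum_comp (Equiv.arrowCongr σ.symm (Equiv.refl (Fin m)))
      (fun e => rename σ (residueTerm e (h e))), ← Finset.sum_sub_distrib]
    refine Finset.sum_congr rfl fun e _ => ?_
    have : Equiv.arrowCongr σ.symm (Equiv.refl (Fin m)) e = e ∘ σ := rfl
    rw [this, rename_residueTerm, residueTerm, residueTerm, residueTerm, map_sub, mul_sub]
  have h0 := sub_eq_zero.mp (eq_zero_of_sum_residueTerm_eq_zero hm hcomp e)
  have hcongr : e ∘ σ = e := funext fun i => he (σ i) i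
  rwa [hcongr] at h0

/-- The given polynomials generate the ring of invariants: an invariant is a sum of terms
`(x_0 ⋯ x_n) ^ a h(x ^ m)` with `h` symmetric. -/
theorem adjoin_monomialInvariants {m n : ℕ} (hm : 0 < m) :
    Algebra.adjoin ℂ (Set.range (monomialInvariants m n)) =
      invariantRing (monomialGroup m (n + 1)) := by
  refine le_antisymm (Algebra.adjoin_le ?_) fun f hf => ?_
  · rintro _ ⟨d, rfl⟩
    exact monomialInvariants_mem_invariantRing m n d
  obtain ⟨h, rfl⟩ := exists_eq_sum_residueTerm hm f
  refine sum_mem fun e _ => ?_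
  by_cases he0 : h e = 0
  · rw [he0, residueTerm, map_zero, mul_zero]
    exact zero_mem _
  have he := eq_of_residue_ne_zero hm hf he0
  refine mul_mem ?_ (expand_mem_adjoin_of_isSymmetric (isSymmetric_residue hm hf he))
  have h0 : ∏ i, X i ^ (e i : ℕ) = monomialInvariants m n 0 ^ (e 0 : ℕ) := by
    rw [monomialInvariants, if_pos (Fin.val_zero _), ← Finset.prod_pow]
    exact Finset.prod_congr rfl fun i _ => by rw [he i 0]
  rw [h0]
  exact pow_mem (Algebra.subset_adjoin (Set.mem_range_self 0)) _

/-- Each `-x_i ^ m` is a root of the monic polynomial `∏ (T + x_j ^ m)`, whose coefficients are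
polynomials in the invariants. -/
theorem isIntegral_X {m n : ℕ} (hm : 0 < m) (i : Fin (n + 1)) :
    IsIntegral (Algebra.adjoin ℂ (Set.range (monomialInvariants m n)))
      (X i : MvPolynomial (Fin (n + 1)) ℂ) := by
  set B := Algebra.adjoin ℂ (Set.range (monomialInvariants m n))
  let Q : Polynomial (MvPolynomial (Fin (n + 1)) ℂ) :=
    ∏ j : Fin (n + 1), (Polynomial.X + Polynomial.C (X j ^ m))
  have hQ : Q = ∑ j ∈ Finset.range (Fintype.card (Fin (n + 1)) + 1),
      Polynomial.C (expand m (esymm (Fin (n + 1)) ℂ j)) *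
        Polynomial.X ^ (Fintype.card (Fin (n + 1)) - j) := by
    have h := congrArg (Polynomial.map (expand m : MvPolynomial (Fin (n + 1)) ℂ →ₐ[ℂ] _).toRingHom)
      (prod_C_add_X_eq_sum_esymm ℂ (Fin (n + 1)))
    simp only [Polynomial.map_prod, Polynomial.map_add, Polynomial.map_X, Polynomial.map_C,
      Polynomial.map_sum, Polynomial.map_mul, Polynomial.map_pow] at h
    refine Eq.trans (Finset.prod_congr rfl fun j _ => ?_) h
    exact congrArg (fun q => Polynomial.X + Polynomial.C q) (expand_X m j).symm
  have hmonic : Q.Monic := Polynomial.monic_prod_of_monic _ _ fun j _ => Polynomial.monic_X_add_C _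
  have hlift : Q ∈ Polynomial.lifts (algebraMap B (MvPolynomial (Fin (n + 1)) ℂ)) := by
    rw [hQ]
    refine sum_mem fun j hj => mul_mem (Polynomial.C'_mem_lifts (Set.mem_range.mpr ?_))
      (Polynomial.X_pow_mem_lifts _ _)
    rw [Finset.mem_range, Fintype.card_fin] at hj
    exact ⟨⟨_, expand_esymm_mem_adjoin m n j (by omega)⟩, rfl⟩
  obtain ⟨P, hPmap, -, hP⟩ := Polynomial.lifts_and_natDegree_eq_and_monic hlift hmonic
  have hint : IsIntegral B (-(X i ^ m) : MvPolynomial (Fin (n + 1)) ℂ) := by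
    refine ⟨P, hP, ?_⟩
    rw [Polynomial.eval₂_eq_eval_map, hPmap, Polynomial.eval_prod]
    exact Finset.prod_eq_zero (Finset.mem_univ i) (by simp)
  refine IsIntegral.of_pow hm ?_
  simpa using hint.neg

/-- The polynomial ring has transcendence degree `n + 1` and is integral over the algebra generated
by the `n + 1` invariants. -/
theorem algebraicIndependent_monomialInvariants {m n : ℕ} (hm : 0 < m) :
    AlgebraicIndependent ℂ (monomialInvariants m n) := by
  have hint : Algebra.IsIntegral (Algebra.adjoin ℂ (Set.range (monomialInvariants m n)))
      (MvPolynomial (Fin (n + 1)) ℂ) := by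
    refine ⟨fun p => ?_⟩
    induction p using MvPolynomial.induction_on with
    | C r =>
      exact isIntegral_algebraMap (R := Algebra.adjoin ℂ (Set.range (monomialInvariants m n)))
        (x := algebraMap ℂ _ r)
    | add p q hp hq => exact hp.add hq
    | mul_X p i hp => exact hp.mul (isIntegral_X hm i)
  have halg : Algebra.IsAlgebraic (Algebra.adjoin ℂ (Set.range (monomialInvariants m n)))
      (MvPolynomial (Fin (n + 1)) ℂ) := inferInstance
  refine (Algebra.IsAlgebraic.isTranscendenceBasis_of_lift_le_trdeg_of_finite ℂ
    (monomialInvariants m n) ?_).1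
  rw [MvPolynomial.trdeg_of_isDomain]
  simp

theorem isBasicInvariants_monomialInvariants {m n : ℕ} (hm : 0 < m) :
    IsBasicInvariants (monomialGroup m (n + 1)) (monomialInvariants m n) :=
  ⟨isHomogeneous_monomialInvariants m n, algebraicIndependent_monomialInvariants hm,
    adjoin_monomialInvariants hm⟩

end ReflArr

theorem mainTheorem12 (m n : ℕ) (hm : 2 ≤ m) (hn : 1 ≤ n) :
    ReflArr.singularLocusIdeal
        (ReflArr.reflectionArrangement (ReflArr.monomialGroup m (n + 1))) =
      ReflArr.minorsIdeal n (ReflArr.monomialMatrix m n) ∧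
    ReflArr.singularLocusIdeal
        (ReflArr.reflectionArrangement (ReflArr.monomialGroup m (n + 1))) =
      Ideal.span (Set.range (ReflArr.monomialGenerator m n)) ∧
    ReflArr.IsBasicInvariants (ReflArr.monomialGroup m (n + 1))
      (ReflArr.monomialInvariants m n) ∧
    ReflArr.singularLocusIdeal
        (ReflArr.reflectionArrangement (ReflArr.monomialGroup m (n + 1))) =
      ReflArr.minorsIdeal n
        (ReflArr.jacobianMatrix fun j : Fin n => ReflArr.monomialInvariants m n j.castSucc) := by
  have hm0 : 0 < m := by omega
  rw [ReflArr.minorsIdeal_jacobianMatrix hm0, ReflArr.minorsIdeal_monomialMatrix hm0 hn]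
  have h := ReflArr.singularLocusIdeal_eq hm hn
  exact ⟨h, h, ReflArr.isBasicInvariants_monomialInvariants hm0, h⟩
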